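/- Let $(V,d)$ be a finite metric space with $n=|V|$ points and distances $d:V\times V\to\mathbb{Q}_{\ge 0}$, let $X\subseteq V$ be a set of terminals, $r\in X$ a root, and $k\ge 1$ an integer. A $k$-hop Steiner tree is a tree $T=(V_T,E_T)$, rooted at $r$, with $X\subseteq V_T\subseteq V$, whose edges are pairs of distinct points of $V$ and in which for every $v\in V_T$ the path from $r$ to $v$ has at most $k$ edges; its cost is $\sum_{\{u,v\}\in E_T}d(u,v)$. The metric $d$ is a tree metric if there is an edge-weighted tree with vertex set $V$ such that $d(u,v)$ is the length of the (shortest) path from $u$ to $v$ in it, for all $u,v\in V$. Theorem. On tree metrics, the problem of finding a $k$-hop Steiner tree of minimum cost can be solved exactly in time $n^{O(k)}$. That is, there are a single program (for a random access machine whose unit-cost operations include addition, subtraction and comparison of rational numbers, but no multiplication) and a constant $C$ such that for all $n$ and $k$ and every instance $(V,d,X,r,k)$ for which $d$ is a tree metric, the program, given the distance matrix of $d$, the set $X$, the root $r$ and the integers $n$ and $k$, halts after at most $C\,n^{Ck}$ steps and outputs a $k$-hop Steiner tree of minimum cost. -/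

import Mathlib

namespace KHop

/-! ### The minimum-cost `k`-hop Steiner tree problem -/

/-- An instance: a finite metric space on `n` points `0, …, n - 1` with rational distances
(nonnegativity follows from the three metric laws), a set of terminals, a root among them, and
a hop bound `k ≥ 1`. -/
structure Problem where
  n : ℕ
  dist : Fin n → Fin n → ℚ
  dist_eq_zero : ∀ u v, dist u v = 0 ↔ u = v
  dist_comm : ∀ u v, dist u v = dist v u
  dist_triangle : ∀ u v w, dist u w ≤ dist u v + dist v w
  terminals : Finset (Fin n)
  root : Fin n
  root_mem : root ∈ terminals
  k : ℕ
  one_le_k : 1 ≤ k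

/-- The weighted graph `(G, w)` induces the metric `d`: the weights are nonnegative, and the length
of a shortest `u`-`v` path in `G` equals `d u v`, for all `u`, `v`. -/
def Induces {V : Type*} (G : SimpleGraph V) (w : Sym2 V → ℚ) (d : V → V → ℚ) : Prop :=
  (∀ e ∈ G.edgeSet, 0 ≤ w e) ∧
    ∀ u v, IsLeast {x : ℚ | ∃ p : G.Walk u v, p.IsPath ∧ x = (p.edges.map w).sum} (d u v)

/-- `d` is a tree metric: some weighted tree on the same vertex set induces it. -/
def IsTreeMetric {V : Type*} (d : V → V → ℚ) : Prop :=
  ∃ (G : SimpleGraph V) (w : Sym2 V → ℚ), G.IsTree ∧ Induces G w d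

namespace Problem

variable (I : Problem)

/-- A `k`-hop Steiner tree: a tree `T = (V_T, E_T)` with `V_T ⊆ V` that contains all terminals and
in which every path from the root has at most `k` edges. Its edges are arbitrary pairs
of distinct points of the metric space. -/
structure IsSteinerTree (T : (⊤ : SimpleGraph (Fin I.n)).Subgraph) : Prop where
  isTree : T.coe.IsTree
  terminals_subset : ∀ v ∈ I.terminals, v ∈ T.verts
  depth_le : ∀ (hr : I.root ∈ T.verts) (v : T.verts) (p : T.coe.Walk ⟨I.root, hr⟩ v),
    p.IsPath → p.length ≤ I.k

/-- The cost of an edge is the distance of its endpoints. -/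
def edgeCost : Sym2 (Fin I.n) → ℚ :=
  Sym2.lift ⟨I.dist, I.dist_comm⟩

/-- The cost of a subgraph is the sum of the costs of its edges. -/
noncomputable def cost (T : (⊤ : SimpleGraph (Fin I.n)).Subgraph) : ℚ :=
  ∑ e ∈ (Set.toFinite T.edgeSet).toFinset, I.edgeCost e

/-- `T` is a `k`-hop Steiner tree of minimum cost. -/
def IsOptimal (T : (⊤ : SimpleGraph (Fin I.n)).Subgraph) : Prop :=
  I.IsSteinerTree T ∧ ∀ T', I.IsSteinerTree T' → I.cost T ≤ I.cost T'

end Problem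

/-! ### The machine model

A random access machine with unit-cost instructions, programmed with assignments, sequencing,
conditionals and loops. The memory consists of two-dimensional arrays of natural numbers
and two-dimensional arrays of rational numbers, each named by a natural number, with computed
indices. The arithmetic operations are addition, subtraction and comparison only; there is no
multiplication, division or rounding, so that the natural numbers, and the numerators of
the rational numbers over a fixed common denominator of the input, grow by at most a constant
number of bits per step, and unit cost is a realistic measure. -/

/-- The memory: `nat a i j` and `rat a i j` are the entries `(i, j)` of the arrays named `a`. -/
structure Store where
  nat : ℕ → ℕ → ℕ → ℕ
  rat : ℕ → ℕ → ℕ → ℚ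

namespace Store

/-- Overwrite one entry of an array of natural numbers. -/
def setNat (s : Store) (a i j x : ℕ) : Store where
  nat := fun a' i' j' => if a' = a ∧ i' = i ∧ j' = j then x else s.nat a' i' j'
  rat := s.rat

/-- Overwrite one entry of an array of rational numbers. -/
def setRat (s : Store) (a i j : ℕ) (x : ℚ) : Store where
  nat := s.nat
  rat := fun a' i' j' => if a' = a ∧ i' = i ∧ j' = j then x else s.rat a' i' j'

end Store

/-- Expressions for natural numbers: constants, array entries, sums, truncated differences. -/
inductive NExpr where
  | lit (c : ℕ)
  | get (a : ℕ) (i j : NExpr)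
  | add (e f : NExpr)
  | sub (e f : NExpr)

/-- Expressions for rational numbers: constants, array entries, sums, differences. -/
inductive RExpr where
  | lit (c : ℚ)
  | get (a : ℕ) (i j : NExpr)
  | add (e f : RExpr)
  | sub (e f : RExpr)

/-- Tests: comparisons of two expressions of the same kind, and Boolean combinations. -/
inductive BExpr where
  | nlt (e f : NExpr)
  | rlt (e f : RExpr)
  | neg (b : BExpr)
  | conj (b c : BExpr)

def NExpr.eval (s : Store) : NExpr → ℕ
  | .lit c => c
  | .get a i j => s.nat a (i.eval s) (j.eval s)
  | .add e f => e.eval s + f.eval s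
  | .sub e f => e.eval s - f.eval s

def RExpr.eval (s : Store) : RExpr → ℚ
  | .lit c => c
  | .get a i j => s.rat a (i.eval s) (j.eval s)
  | .add e f => e.eval s + f.eval s
  | .sub e f => e.eval s - f.eval s

def BExpr.Holds (s : Store) : BExpr → Prop
  | .nlt e f => e.eval s < f.eval s
  | .rlt e f => e.eval s < f.eval s
  | .neg b => ¬ b.Holds s
  | .conj b c => b.Holds s ∧ c.Holds s

/-- Programs. `setNat a i j e` is the assignment `a[i, j] := e`. -/
inductive Prog where
  | skip
  | setNat (a : ℕ) (i j e : NExpr)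
  | setRat (a : ℕ) (i j : NExpr) (e : RExpr)
  | seq (p q : Prog)
  | ite (b : BExpr) (p q : Prog)
  | loop (b : BExpr) (p : Prog)

/-- `Exec p s t s'`: started with memory `s`, the program `p` halts after exactly `t` steps with
memory `s'`. Each assignment and each evaluation of a test is one step (the expressions in
a program have constant size). -/
inductive Exec : Prog → Store → ℕ → Store → Prop where
  | skip (s : Store) : Exec .skip s 1 s
  | setNat (a : ℕ) (i j e : NExpr) (s : Store) :
      Exec (.setNat a i j e) s 1 (s.setNat a (i.eval s) (j.eval s) (e.eval s))
  | setRat (a : ℕ) (i j : NExpr) (e : RExpr) (s : Store) :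
      Exec (.setRat a i j e) s 1 (s.setRat a (i.eval s) (j.eval s) (e.eval s))
  | seq {p q : Prog} {s s' s'' : Store} {t t' : ℕ} :
      Exec p s t s' → Exec q s' t' s'' → Exec (.seq p q) s (t + t') s''
  | ite_true {b : BExpr} {p q : Prog} {s s' : Store} {t : ℕ} :
      b.Holds s → Exec p s t s' → Exec (.ite b p q) s (t + 1) s'
  | ite_false {b : BExpr} {p q : Prog} {s s' : Store} {t : ℕ} :
      ¬ b.Holds s → Exec q s t s' → Exec (.ite b p q) s (t + 1) s'
  | loop_true {b : BExpr} {p : Prog} {s s' s'' : Store} {t t' : ℕ} :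
      b.Holds s → Exec p s t s' → Exec (.loop b p) s' t' s'' →
        Exec (.loop b p) s (t + t' + 1) s''
  | loop_false {b : BExpr} {p : Prog} {s : Store} :
      ¬ b.Holds s → Exec (.loop b p) s 1 s

/-! ### Input and output -/

/-- The initial memory for an instance. Arrays of natural numbers: the entry `(0, 0)` of array `0`
is the number of points, of array `1` the hop bound, of array `2` the root, and array `3`
holds the indicator of the terminals in its entries `(v, 0)`. Array `0` of rational numbers
is the distance matrix. Everything else is zero. -/
def Problem.input (I : Problem) : Store where
  nat := fun a i j =>
    if a = 0 ∧ i = 0 ∧ j = 0 then I.n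
    else if a = 1 ∧ i = 0 ∧ j = 0 then I.k
    else if a = 2 ∧ i = 0 ∧ j = 0 then I.root
    else if a = 3 ∧ j = 0 then (if ∃ v ∈ I.terminals, (v : ℕ) = i then 1 else 0)
    else 0
  rat := fun a i j =>
    if h : a = 0 ∧ i < I.n ∧ j < I.n then I.dist ⟨i, h.2.1⟩ ⟨j, h.2.2⟩ else 0

/-- The memory `s` holds the subgraph `T` as output: array `4` of natural numbers holds the
indicator of its vertex set in the entries `(v, 0)`, and array `5` its adjacency matrix. -/
def Problem.IsOutput (I : Problem) (s : Store)
    (T : (⊤ : SimpleGraph (Fin I.n)).Subgraph) : Prop :=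
  (∀ v : Fin I.n, (v ∈ T.verts ∧ s.nat 4 v 0 = 1) ∨ (v ∉ T.verts ∧ s.nat 4 v 0 = 0)) ∧
    ∀ u v : Fin I.n, (T.Adj u v ∧ s.nat 5 u v = 1) ∨ (¬ T.Adj u v ∧ s.nat 5 u v = 0)

end KHop

/-! The theorem rests on a dynamic program over the tree that underlies the metric. A solution is
encoded locally: each point `v` carries a state that names, for every depth `i`, a point `x_i(v)`,
intended to be the point of the solution of depth at most `i` that is nearest to `v`. The depth of
`v` is the least `i` with `x_i(v) = v`, and for positive depth `v` pays its distance to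
`x_{i-1}(v)`, its parent in the solution.

Adjacent points of the metric tree have to be consistent: if the path from `v` to `x_i(v)` runs
through the neighbour `p`, then `x_i(p) = x_i(v)`. This suffices for soundness, even if `x_i(v)` is
not nearest. Along the path from `v` to `x = x_i(v)` every point names `x`, so `x` names itself
(`digit_digit_eq`) and has depth at most `i`. Thus depths decrease towards parents, and the parent
edges form a `k`-hop Steiner tree that costs no more than the assignment
(`Valid.exists_isSteinerTree`). Conversely, given any `k`-hop Steiner tree, naming the truly nearest
points, with ties broken by one global numbering, is consistent (`IsNearest.not_conflict`). It costs
no more than the tree, because the parent of a point is among the candidates for its nearest point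
(`IsSteinerTree.exists_totalCost_le`).

A violated condition costs `big`, which exceeds the cost of the star at the root
(`exists_totalCost_lt`), so an assignment of minimum cost violates none. The objective is now a sum
of terms on points and on edges of the metric tree. It is minimised by eliminating points in order
of decreasing distance from the root (`runs_progEliminateAll`), the tree being recovered from the
distances alone. With `S = n ^ (min k n + 1)` states, each elimination compares all pairs of states
at all depths, and the total time is `O(S ^ 4)`. -/

namespace KHop

/-! ### Reasoning about programs -/

/-- From `s`, the program `p` halts within `T` steps in a memory satisfying `Q`. -/
def Runs (p : Prog) (s : Store) (T : ℕ) (Q : Store → Prop) : Prop :=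
  ∃ t s', Exec p s t s' ∧ t ≤ T ∧ Q s'

/-- `p` contains no assignment to the array `a` of natural numbers. -/
def Prog.keepsNat (a : ℕ) : Prog → Bool
  | .skip => true
  | .setNat b _ _ _ => b != a
  | .setRat _ _ _ _ => true
  | .seq p q => p.keepsNat a && q.keepsNat a
  | .ite _ p q => p.keepsNat a && q.keepsNat a
  | .loop _ p => p.keepsNat a

/-- `p` contains no assignment to the array `a` of rational numbers. -/
def Prog.keepsRat (a : ℕ) : Prog → Bool
  | .skip => true
  | .setNat _ _ _ _ => true
  | .setRat b _ _ _ => b != a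
  | .seq p q => p.keepsRat a && q.keepsRat a
  | .ite _ p q => p.keepsRat a && q.keepsRat a
  | .loop _ p => p.keepsRat a

/-- The memories agree on the arrays that `p` does not assign to. -/
structure Agree (p : Prog) (s s' : Store) : Prop where
  nat : ∀ a, p.keepsNat a = true → s'.nat a = s.nat a
  rat : ∀ a, p.keepsRat a = true → s'.rat a = s.rat a

/-- The frame rule. Since `keepsNat` and `keepsRat` are computable syntactic checks, their instances
for concrete programs close by `rfl`. -/
theorem Exec.agree {p : Prog} {s s' : Store} {t : ℕ} (h : Exec p s t s') : Agree p s s' := by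
  induction h with
  | skip s => exact ⟨fun _ _ => rfl, fun _ _ => rfl⟩
  | setNat a i j e s =>
    refine ⟨fun b hb => ?_, fun _ _ => rfl⟩
    have : b ≠ a := by rintro rfl; simp [Prog.keepsNat] at hb
    simp [Store.setNat, this]
  | setRat a i j e s =>
    refine ⟨fun _ _ => rfl, fun b hb => ?_⟩
    have : b ≠ a := by rintro rfl; simp [Prog.keepsRat] at hb
    simp [Store.setRat, this]
  | seq _ _ h₁ h₂ =>
    refine ⟨fun a ha => ?_, fun a ha => ?_⟩
    · simp only [Prog.keepsNat, Bool.and_eq_true] at ha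
      rw [h₂.nat a ha.2, h₁.nat a ha.1]
    · simp only [Prog.keepsRat, Bool.and_eq_true] at ha
      rw [h₂.rat a ha.2, h₁.rat a ha.1]
  | ite_true _ _ h =>
    refine ⟨fun a ha => ?_, fun a ha => ?_⟩
    · simp only [Prog.keepsNat, Bool.and_eq_true] at ha
      exact h.nat a ha.1
    · simp only [Prog.keepsRat, Bool.and_eq_true] at ha
      exact h.rat a ha.1
  | ite_false _ _ h =>
    refine ⟨fun a ha => ?_, fun a ha => ?_⟩
    · simp only [Prog.keepsNat, Bool.and_eq_true] at ha
      exact h.nat a ha.2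
    · simp only [Prog.keepsRat, Bool.and_eq_true] at ha
      exact h.rat a ha.2
  | loop_true _ _ _ h₁ h₂ =>
    exact ⟨fun a ha => (h₂.nat a ha).trans (h₁.nat a ha),
      fun a ha => (h₂.rat a ha).trans (h₁.rat a ha)⟩
  | loop_false _ => exact ⟨fun _ _ => rfl, fun _ _ => rfl⟩

namespace Runs

variable {p q : Prog} {s : Store} {T T' : ℕ} {Q R : Store → Prop}

theorem mono (h : Runs p s T Q) (hT : T ≤ T') (hQ : ∀ s', Q s' → R s') : Runs p s T' R := by
  obtain ⟨t, s', h₁, h₂, h₃⟩ := h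
  exact ⟨t, s', h₁, h₂.trans hT, hQ s' h₃⟩

theorem frame (h : Runs p s T Q) : Runs p s T (fun s' => Agree p s s' ∧ Q s') := by
  obtain ⟨t, s', h₁, h₂, h₃⟩ := h
  exact ⟨t, s', h₁, h₂, h₁.agree, h₃⟩

theorem skip (h : Q s) : Runs .skip s 1 Q := ⟨1, s, .skip s, le_rfl, h⟩

theorem setNat {a : ℕ} {i j e : NExpr} (h : Q (s.setNat a (i.eval s) (j.eval s) (e.eval s))) :
    Runs (.setNat a i j e) s 1 Q := ⟨1, _, .setNat a i j e s, le_rfl, h⟩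

theorem setRat {a : ℕ} {i j : NExpr} {e : RExpr}
    (h : Q (s.setRat a (i.eval s) (j.eval s) (e.eval s))) :
    Runs (.setRat a i j e) s 1 Q := ⟨1, _, .setRat a i j e s, le_rfl, h⟩

theorem seq (h : Runs p s T (fun s' => Runs q s' T' Q)) : Runs (.seq p q) s (T + T') Q := by
  obtain ⟨t, s', h₁, h₂, t', s'', h₃, h₄, h₅⟩ := h
  exact ⟨t + t', s'', .seq h₁ h₃, by omega, h₅⟩

/-- Sequential composition, the memory in between being known up to the frame of `p`. -/
theorem seq' (h : Runs p s T R) (h' : ∀ s', Agree p s s' → R s' → Runs q s' T' Q) :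
    Runs (.seq p q) s (T + T') Q :=
  seq (h.frame.mono le_rfl fun s' hs => h' s' hs.1 hs.2)

theorem ite {b : BExpr} (h₁ : b.Holds s → Runs p s T Q) (h₂ : ¬ b.Holds s → Runs q s T Q) :
    Runs (.ite b p q) s (T + 1) Q := by
  by_cases hb : b.Holds s
  · obtain ⟨t, s', h₃, h₄, h₅⟩ := h₁ hb
    exact ⟨t + 1, s', .ite_true hb h₃, by omega, h₅⟩
  · obtain ⟨t, s', h₃, h₄, h₅⟩ := h₂ hb
    exact ⟨t + 1, s', .ite_false hb h₃, by omega, h₅⟩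

end Runs

/-- The scalar variable held in the array `a`. -/
@[reducible] def var (a : ℕ) : NExpr := .get a (.lit 0) (.lit 0)

/-- Assignment to the scalar variable held in the array `a`. -/
@[reducible] def assign (a : ℕ) (e : NExpr) : Prog := .setNat a (.lit 0) (.lit 0) e

/-- The rational scalar variable held in the array `a`. -/
@[reducible] def ratVar (a : ℕ) : RExpr := .get a (.lit 0) (.lit 0)

/-- Assignment to the rational scalar variable held in the array `a`. -/
@[reducible] def assignRat (a : ℕ) (e : RExpr) : Prog := .setRat a (.lit 0) (.lit 0) e

/-- Disequality of natural numbers. -/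
def BExpr.nne (e f : NExpr) : BExpr := .neg (.conj (.neg (.nlt e f)) (.neg (.nlt f e)))

@[simp] theorem BExpr.holds_nne (s : Store) (e f : NExpr) :
    (BExpr.nne e f).Holds s ↔ e.eval s ≠ f.eval s := by
  simp only [BExpr.nne, BExpr.Holds]
  omega

/-- `for c := 0 to N - 1 do p`. -/
def forLoop (c : ℕ) (N : NExpr) (p : Prog) : Prog :=
  .seq (assign c (.lit 0)) (.loop (.nlt (var c) N) (.seq p (assign c (.add (var c) (.lit 1)))))

theorem Agree.trans {p : Prog} {s s' s'' : Store} (h : Agree p s s') (h' : Agree p s' s'') :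
    Agree p s s'' :=
  ⟨fun a ha => (h'.nat a ha).trans (h.nat a ha), fun a ha => (h'.rat a ha).trans (h.rat a ha)⟩

/-- The invariant speaks of the memory after the counter has been advanced. A round costs its body,
a test and an increment; the last two steps are the initialisation and the failing test. -/
theorem Runs.forLoop {c : ℕ} {N : NExpr} {p : Prog} {s₀ : Store} {m T : ℕ}
    (Inv : ℕ → Store → Prop) (hc : p.keepsNat c = true)
    (hN : ∀ s, Agree (forLoop c N p) s₀ s → N.eval s = m)
    (h0 : Inv 0 (s₀.setNat c 0 0 0))
    (hstep : ∀ j < m, ∀ s, Agree (KHop.forLoop c N p) s₀ s → s.nat c 0 0 = j → Inv j s →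
      Runs p s T (fun s' => Inv (j + 1) (s'.setNat c 0 0 (j + 1)))) :
    Runs (KHop.forLoop c N p) s₀ (m * (T + 2) + 2) (Inv m) := by
  have hlift : ∀ {s s'}, Agree (.seq p (assign c (.add (var c) (.lit 1)))) s s' →
      Agree (KHop.forLoop c N p) s s' := by
    refine fun h => ⟨fun a ha => h.nat a ?_, fun a ha => h.rat a ?_⟩
    · simp only [KHop.forLoop, Prog.keepsNat, Bool.and_eq_true] at ha
      simpa [Prog.keepsNat] using ha.2
    · simp only [KHop.forLoop, Prog.keepsRat, Bool.and_eq_true] at ha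
      simpa [Prog.keepsRat] using ha.2
  -- Induction on the number `r` of rounds that are left.
  have key : ∀ r j, j + r = m → ∀ s, Agree (KHop.forLoop c N p) s₀ s → s.nat c 0 0 = j →
      Inv j s → Runs (.loop (.nlt (var c) N) (.seq p (assign c (.add (var c) (.lit 1))))) s
        (r * (T + 2) + 1) (Inv m) := by
    intro r
    induction r with
    | zero =>
      intro j hj s hs hcj hI
      refine ⟨1, s, .loop_false ?_, by omega, by rwa [← hj]⟩
      simp only [BExpr.Holds, hN s hs, NExpr.eval, hcj]
      omega
    | succ r ih =>
      intro j hj s hs hcj hI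
      obtain ⟨t, s', h₁, h₂, h₃⟩ := hstep j (by omega) s hs hcj hI
      have hc' : s'.nat c 0 0 = j := by rw [h₁.agree.nat c hc, hcj]
      have h₄ : Exec (.seq p (assign c (.add (var c) (.lit 1)))) s (t + 1)
          (s'.setNat c 0 0 (j + 1)) := by
        have := Exec.seq h₁ (.setNat c (.lit 0) (.lit 0) (.add (var c) (.lit 1)) s')
        simpa [NExpr.eval, hc'] using this
      obtain ⟨t', s'', h₅, h₆, h₇⟩ := ih (j + 1) (by omega) _ (hs.trans (hlift h₄.agree))
        (by simp [Store.setNat]) h₃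
      refine ⟨t + 1 + t' + 1, s'', .loop_true ?_ h₄ h₅, ?_, h₇⟩
      · simp only [BExpr.Holds, hN s hs, NExpr.eval, hcj]
        omega
      · rw [Nat.succ_mul]; omega
  refine (Runs.seq (T := 1) (T' := m * (T + 2) + 1) (Runs.setNat ?_)).mono (by omega)
    fun _ h => h
  refine key m 0 (by omega) _ ⟨fun a ha => ?_, fun _ _ => rfl⟩ (by simp [Store.setNat, NExpr.eval])
    h0
  simp only [KHop.forLoop, Prog.keepsNat, Bool.and_eq_true, bne_iff_ne] at ha
  simp [Store.setNat, ha.1.symm]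

/-! ### States, costs and penalties of the dynamic program -/

namespace Problem

variable (I : Problem)

/-- The distance matrix, extended by zero. -/
def matrix (u v : ℕ) : ℚ := if h : u < I.n ∧ v < I.n then I.dist ⟨u, h.1⟩ ⟨v, h.2⟩ else 0

/-- The number of possible depths: trees of depth at most `min k n` suffice. -/
def levels : ℕ := min I.k I.n + 1

/-- A state of a point assigns to each depth a point. States are coded by numbers. -/
def numStates : ℕ := I.n ^ I.levels

/-- The point which the state `s` assigns to the depth `i`. -/
def digit (s i : ℕ) : ℕ := s / I.n ^ i % I.n

/-- A number larger than the cost of some Steiner tree. -/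
def big : ℚ := 1 + ∑ v ∈ Finset.range I.n, I.matrix I.root v

/-- The first `i < m` to which `s` assigns `v`, or `m` if there is none. -/
def labelBelow (v s : ℕ) : ℕ → ℕ
  | 0 => 0
  | m + 1 => if labelBelow v s m = m ∧ I.digit s m ≠ v then m + 1 else labelBelow v s m

/-- The depth of the point `v` in state `s`; it is `levels` if `v` is unused. -/
def label (v s : ℕ) : ℕ := I.labelBelow v s I.levels

/-- The number `v` stands for a terminal. -/
def IsTerminal (v : ℕ) : Prop := ∃ u ∈ I.terminals, (u : ℕ) = v

open Classical in
/-- The cost of joining `v` in state `s` to its parent. -/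
noncomputable def vertexCost (v s : ℕ) : ℚ :=
  if I.digit s 0 ≠ I.root then I.big
  else if I.label v s < I.levels then
    if 0 < I.label v s then I.matrix v (I.digit s (I.label v s - 1)) else 0
  else if I.IsTerminal v then I.big else 0

/-- The states `s` of `v` and `s'` of `p` differ at depth `i` although `p` lies between `v` and
the point assigned to `v`, or `v` between `p` and the point assigned to `p`. -/
def Conflict (v p s s' i : ℕ) : Prop :=
  I.digit s i ≠ I.digit s' i ∧
    ¬ (I.matrix v (I.digit s i) < I.matrix v p + I.matrix p (I.digit s i) ∧
      I.matrix p (I.digit s' i) < I.matrix p v + I.matrix v (I.digit s' i))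

open Classical in
/-- The penalty for conflicts between the states `s` of `v` and `s'` of its neighbour `p`. -/
noncomputable def edgePenalty (v p s s' : ℕ) : ℚ :=
  if v ≠ I.root ∧ ∃ i < I.levels, I.Conflict v p s s' i then I.big else 0

/-- The points in order of decreasing distance from the root. -/
def Before (u v : ℕ) : Prop :=
  I.matrix I.root v < I.matrix I.root u ∨ (¬ I.matrix I.root u < I.matrix I.root v ∧ u < v)

open Classical in
/-- The number of points before `v`. -/
noncomputable def rank (v : ℕ) : ℕ := ((Finset.range I.n).filter (I.Before · v)).card

/-- `p` is the neighbour of `v` on the way to the root. -/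
structure IsParent (v p : ℕ) : Prop where
  lt : p < I.n
  ne : p ≠ v
  between : I.matrix I.root v = I.matrix I.root p + I.matrix p v
  closest : ∀ u < I.n, u ≠ v → I.matrix I.root v = I.matrix I.root u + I.matrix u v →
    I.matrix p v ≤ I.matrix u v

/-- All points other than the root have their parents, and the root has the parent `n`. -/
structure IsParentMap (par : ℕ → ℕ) : Prop where
  root : par I.root = I.n
  isParent : ∀ v < I.n, v ≠ I.root → I.IsParent v (par v)

/-- The total cost of an assignment of states to points. -/
noncomputable def totalCost (par σ : ℕ → ℕ) : ℚ :=
  ∑ v ∈ Finset.range I.n, (I.vertexCost v (σ v) + I.edgePenalty v (par v) (σ v) (σ (par v)))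

/-- `p` is the parent of `v` in the solution coded by `σ`. -/
def Joins (σ : ℕ → ℕ) (v p : ℕ) : Prop :=
  0 < I.label v (σ v) ∧ I.label v (σ v) < I.levels ∧ I.digit (σ v) (I.label v (σ v) - 1) = p

end Problem

/-! ### The program -/

/-- Array 6 receives the number of levels. -/
def progLevels : Prog :=
  .ite (.nlt (var 1) (var 0)) (assign 6 (.add (var 1) (.lit 1))) (assign 6 (.add (var 0) (.lit 1)))

/-- Array 7 receives the number of states. -/
def progStates : Prog :=
  .seq (assign 7 (.lit 1)) <|
  forLoop 9 (var 6) <|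
    .seq (assign 8 (.lit 0)) <|
    -- Multiplication by `n` as repeated addition.
    .seq (forLoop 10 (var 0) (assign 8 (.add (var 8) (var 7)))) <|
    assign 7 (var 8)

/-- Array 16 receives the digits of the states. -/
def progDigits : Prog :=
  .seq (assign 14 (.lit 0)) <|
  .seq (assign 15 (.lit 0)) <|
  forLoop 9 (var 7) <|
    .seq (.setNat 16 (var 9) (.lit 0) (var 15)) <|
    -- Digit `i + 1` of `j` is digit `i` of `j / n`. Arrays 14 and 15 maintain `j / n` and `j % n`,
    -- so no division is needed.
    .seq (forLoop 10 (.sub (var 6) (.lit 1)) <|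
      .setNat 16 (var 9) (.add (var 10) (.lit 1)) (.get 16 (var 14) (var 10))) <|
    .ite (.nlt (.add (var 15) (.lit 1)) (var 0))
      (assign 15 (.add (var 15) (.lit 1)))
      (.seq (assign 15 (.lit 0)) (assign 14 (.add (var 14) (.lit 1))))

/-- The rational array 1 receives the large number. -/
def progBig : Prog :=
  .seq (assignRat 1 (.lit 1)) <|
  forLoop 9 (var 0) (assignRat 1 (.add (ratVar 1) (.get 0 (var 2) (var 9))))

/-- Array 17 receives the order of the points. -/
def progOrder : Prog :=
  forLoop 9 (var 0) <|
    .seq (assign 23 (.lit 0)) <|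
    .seq (forLoop 10 (var 0) <|
      .ite (.neg (.conj (.neg (.rlt (.get 0 (var 2) (var 9)) (.get 0 (var 2) (var 10))))
          (.neg (.conj (.neg (.rlt (.get 0 (var 2) (var 10)) (.get 0 (var 2) (var 9))))
            (.nlt (var 10) (var 9))))))
        (assign 23 (.add (var 23) (.lit 1))) .skip) <|
    .setNat 17 (var 23) (.lit 0) (var 9)

/-- Array 18 receives the parents of the points. -/
def progParents : Prog :=
  .seq (forLoop 9 (var 0) <|
    .seq (assign 23 (var 2)) <|
    .seq (forLoop 10 (var 0) <|
      .ite (.conj (.nne (var 10) (var 9))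
          (.conj (.neg (.rlt (.get 0 (var 2) (var 9))
            (.add (.get 0 (var 2) (var 10)) (.get 0 (var 10) (var 9)))))
            (.rlt (.get 0 (var 10) (var 9)) (.get 0 (var 23) (var 9)))))
        (assign 23 (var 10)) .skip) <|
    .setNat 18 (var 9) (.lit 0) (var 23)) <|
  .setNat 18 (var 2) (.lit 0) (var 0)

/-- Array 19 receives the labels, and the rational array 2 the costs of the points. -/
def progCosts : Prog :=
  forLoop 9 (var 0) <|
  forLoop 10 (var 7) <|
    .seq (assign 23 (.lit 0)) <|
    .seq (forLoop 11 (var 6) <|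
      .ite (.conj (.neg (.nne (var 23) (var 11))) (.nne (.get 16 (var 10) (var 11)) (var 9)))
        (assign 23 (.add (var 11) (.lit 1))) .skip) <|
    .seq (.setNat 19 (var 9) (var 10) (var 23)) <|
    .ite (.nne (.get 16 (var 10) (.lit 0)) (var 2))
      (.setRat 2 (var 9) (var 10) (ratVar 1))
      (.ite (.nlt (var 23) (var 6))
        (.ite (.nlt (.lit 0) (var 23))
          (.setRat 2 (var 9) (var 10)
            (.get 0 (var 9) (.get 16 (var 10) (.sub (var 23) (.lit 1)))))
          (.setRat 2 (var 9) (var 10) (.lit 0)))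
        (.ite (.nlt (.lit 0) (.get 3 (var 9) (.lit 0)))
          (.setRat 2 (var 9) (var 10) (ratVar 1))
          (.setRat 2 (var 9) (var 10) (.lit 0))))

/-- The rational variable 4 receives the cost of state `11` of the point `24`, if its
parent `25` is in state `10`. -/
def progValue : Prog :=
  .seq (assignRat 4 (.lit 0)) <|
  .seq (.ite (.nne (var 24) (var 2))
    (forLoop 12 (var 6) <|
      .ite (.conj (.nne (.get 16 (var 11) (var 12)) (.get 16 (var 10) (var 12)))
          (.neg (.conj
            (.rlt (.get 0 (var 24) (.get 16 (var 11) (var 12)))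
              (.add (.get 0 (var 24) (var 25)) (.get 0 (var 25) (.get 16 (var 11) (var 12)))))
            (.rlt (.get 0 (var 25) (.get 16 (var 10) (var 12)))
              (.add (.get 0 (var 25) (var 24)) (.get 0 (var 24) (.get 16 (var 10) (var 12))))))))
        (assignRat 4 (ratVar 1)) .skip)
    .skip) <|
  assignRat 4 (.add (.get 2 (var 24) (var 11)) (ratVar 4))

/-- Variable 22 receives the best state of the point `24`, if its parent `25` is in
state `10`, and the rational variable 3 its cost. -/
def progBest : Prog :=
  forLoop 11 (var 7) <|
    .seq progValue <|
    -- State 0 is accepted unconditionally, because the rational variable 3 then still holds a stale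
    -- value.
    .ite (.neg (.conj (.neg (.nlt (var 11) (.lit 1))) (.neg (.rlt (ratVar 4) (ratVar 3)))))
      (.seq (assignRat 3 (ratVar 4)) (assign 22 (var 11))) .skip

/-- Elimination of the point `24` with parent `25`. -/
def progEliminate : Prog :=
  forLoop 10 (var 7) <|
    .seq progBest <|
    .seq (.setRat 2 (var 25) (var 10) (.add (.get 2 (var 25) (var 10)) (ratVar 3))) <|
    .setNat 20 (var 24) (var 10) (var 22)

/-- Elimination of all points. -/
def progEliminateAll : Prog :=
  forLoop 9 (var 0) <|
    .seq (assign 24 (.get 17 (var 9) (.lit 0))) <|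
    .seq (assign 25 (.get 18 (var 24) (.lit 0))) <|
    progEliminate

/-- Array 21 receives an optimal assignment of states to points. -/
def progChoose : Prog :=
  forLoop 9 (var 0) <|
    -- Ranks decrease, so the state of a parent is fixed before those of its children. The
    -- fictitious parent `n` of the root keeps the state 0 of the initial memory.
    .seq (assign 24 (.get 17 (.sub (.sub (var 0) (.lit 1)) (var 9)) (.lit 0))) <|
    .setNat 21 (var 24) (.lit 0) (.get 20 (var 24) (.get 21 (.get 18 (var 24) (.lit 0)) (.lit 0)))

/-- Output of the solution. -/
def progOutput : Prog :=
  forLoop 9 (var 0) <|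
    .seq (assign 23 (.get 19 (var 9) (.get 21 (var 9) (.lit 0)))) <|
    .ite (.nlt (var 23) (var 6))
      (.seq (.setNat 4 (var 9) (.lit 0) (.lit 1)) <|
        .ite (.nlt (.lit 0) (var 23))
          (.seq (assign 24 (.get 16 (.get 21 (var 9) (.lit 0)) (.sub (var 23) (.lit 1)))) <|
            .seq (.setNat 5 (var 9) (var 24) (.lit 1)) <|
            .setNat 5 (var 24) (var 9) (.lit 1))
          .skip)
      .skip

/-- The program for the minimum-cost `k`-hop Steiner tree problem on tree metrics. -/
def steinerProg : Prog :=
  .seq progLevels <| .seq progStates <| .seq progDigits <| .seq progBig <| .seq progOrder <|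
  .seq progParents <| .seq progCosts <| .seq progEliminateAll <| .seq progChoose progOutput

/-! ### Correctness and running time of the preprocessing -/

/-- The arrays of the input that the program never changes. -/
structure Base (I : Problem) (s : Store) : Prop where
  n : s.nat 0 0 0 = I.n
  k : s.nat 1 0 0 = I.k
  root : s.nat 2 0 0 = I.root
  terminals : ∀ v, 0 < s.nat 3 v 0 ↔ I.IsTerminal v
  matrix : s.rat 0 = I.matrix

variable {I : Problem} {s : Store}

theorem Problem.n_pos (I : Problem) : 0 < I.n := I.root.pos

theorem Problem.digit_lt (I : Problem) (s i : ℕ) : I.digit s i < I.n := Nat.mod_lt _ I.n_pos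

theorem Base.input (I : Problem) : Base I I.input := by
  refine ⟨by simp [Problem.input], by simp [Problem.input], by simp [Problem.input], ?_, ?_⟩
  · intro v
    simp only [Problem.input, Problem.IsTerminal]
    split_ifs <;> simp_all
  · funext u v
    simp [Problem.input, Problem.matrix]

theorem Base.agree {p : Prog} {s s' : Store} (h : Base I s) (ha : Agree p s s')
    (hp : (p.keepsNat 0 && p.keepsNat 1 && p.keepsNat 2 && p.keepsNat 3 && p.keepsRat 0) = true) :
    Base I s' := by
  simp only [Bool.and_eq_true] at hp
  obtain ⟨⟨⟨⟨h0, h1⟩, h2⟩, h3⟩, h4⟩ := hp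
  exact ⟨by rw [ha.nat 0 h0, h.n], by rw [ha.nat 1 h1, h.k], by rw [ha.nat 2 h2, h.root],
    by rw [ha.nat 3 h3]; exact h.terminals, by rw [ha.rat 0 h4, h.matrix]⟩

theorem runs_progLevels (h : Base I s) :
    Runs progLevels s 2 (fun s' => s'.nat 6 0 0 = I.levels) := by
  refine Runs.ite (fun hb => Runs.setNat ?_) (fun hb => Runs.setNat ?_) <;>
    simp [BExpr.Holds, NExpr.eval, h.n, h.k] at hb <;>
    simp [Store.setNat, NExpr.eval, h.n, h.k, Problem.levels] <;> omega

theorem runs_progStates (h : Base I s) (h6 : s.nat 6 0 0 = I.levels) :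
    Runs progStates s (1 + (I.levels * (1 + ((I.n * (1 + 2) + 2) + 1) + 2) + 2))
      (fun s' => s'.nat 7 0 0 = I.numStates) := by
  refine Runs.seq (Runs.setNat ?_)
  refine Runs.forLoop (fun j s => s.nat 7 0 0 = I.n ^ j) (by rfl) ?_ ?_ ?_
  · intro s' hs
    simp [NExpr.eval, hs.nat 6 rfl, Store.setNat, h6]
  · simp [Store.setNat, NExpr.eval]
  · intro j hj s₁ hs _ h7
    refine Runs.seq (Runs.setNat ?_)
    have hn : s₁.nat 0 0 0 = I.n := by
      rw [hs.nat 0 rfl]; simp [Store.setNat, h.n]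
    refine Runs.seq' (R := fun s => s.nat 8 0 0 = I.n * I.n ^ j) ?_ ?_
    · refine Runs.forLoop (fun i s => s.nat 8 0 0 = i * I.n ^ j) (by rfl) ?_ ?_ ?_
      · intro s' hs'
        simp [NExpr.eval, hs'.nat 0 rfl, Store.setNat, hn]
      · simp [Store.setNat, NExpr.eval]
      · intro i hi s₂ hs₂ _ h8
        refine Runs.setNat ?_
        have h7' : s₂.nat 7 0 0 = I.n ^ j := by
          rw [hs₂.nat 7 rfl]; simp [Store.setNat, h7]
        simp [Store.setNat, NExpr.eval, h8, h7']
        ring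
    · intro s₂ _ h8
      refine Runs.setNat ?_
      simp [Store.setNat, NExpr.eval, h8]
      ring

theorem runs_progDigits (h : Base I s) (h6 : s.nat 6 0 0 = I.levels)
    (h7 : s.nat 7 0 0 = I.numStates) :
    Runs progDigits s
      (1 + (1 + (I.numStates * (1 + (((I.levels - 1) * (1 + 2) + 2) + (1 + 1 + 1)) + 2) + 2)))
      (fun s' => ∀ x < I.numStates, ∀ i < I.levels, s'.nat 16 x i = I.digit x i) := by
  refine Runs.seq (Runs.setNat ?_)
  refine Runs.seq (Runs.setNat ?_)
  refine (Runs.forLoop (fun j s => s.nat 14 0 0 = j / I.n ∧ s.nat 15 0 0 = j % I.n ∧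
    ∀ x < j, ∀ i < I.levels, s.nat 16 x i = I.digit x i) (by rfl) ?_ ?_ ?_).mono le_rfl
    fun _ h => h.2.2
  · intro s' hs
    simp [NExpr.eval, hs.nat 7 rfl, Store.setNat, h7]
  · simp [Store.setNat, NExpr.eval]
  · rintro j hj s₁ hs h9 ⟨h14, h15, h16⟩
    refine Runs.seq (Runs.setNat ?_)
    refine Runs.seq' (R := fun s => ∀ x ≤ j, ∀ i < I.levels, s.nat 16 x i = I.digit x i) ?_ ?_
    · have hl : 0 < I.levels := Nat.succ_pos _
      -- The invariant includes the finished part of row `j`: for `j = 0` the row `j / n` that is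
      -- being copied is row `j` itself.
      refine (Runs.forLoop (m := I.levels - 1) (fun m s => ∀ x ≤ j, ∀ i < I.levels,
        (x < j ∨ i ≤ m) → s.nat 16 x i = I.digit x i) (by rfl) ?_ ?_ ?_).mono le_rfl ?_
      · intro s' hs'
        simp [NExpr.eval, hs'.nat 6 rfl, Store.setNat, hs.nat 6 rfl, h6]
      · intro x hx i hi hxi
        by_cases hxj : x = j
        · obtain rfl : i = 0 := by omega
          simp [Store.setNat, NExpr.eval, hxj, h9, h15, Problem.digit]
        · simp [Store.setNat, NExpr.eval, hxj, h9]
          exact h16 x (by omega) i hi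
      · intro m hm s₂ hs₂ h10 hI
        refine Runs.setNat ?_
        have h14' : s₂.nat 14 0 0 = j / I.n := by
          rw [hs₂.nat 14 rfl]; simp [Store.setNat, h14]
        have h9' : s₂.nat 9 0 0 = j := by
          rw [hs₂.nat 9 rfl]; simp [Store.setNat, h9]
        intro x hx i hi hxi
        simp only [Store.setNat, NExpr.eval, h10, h9', h14']
        by_cases hc : x = j ∧ i = m + 1
        · simp only [hc, and_self, if_true, Nat.reduceEqDiff, false_and, if_false]
          rw [hI (j / I.n) (Nat.div_le_self _ _) m (by omega) (by right; omega)]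
          rw [Problem.digit, Problem.digit, Nat.div_div_eq_div_mul, pow_succ']
        · simp only [Nat.reduceEqDiff, false_and, if_false, true_and, hc]
          exact hI x hx i hi (by omega)
      · intro s' hs' x hx i hi
        exact hs' x hx i hi (by right; omega)
    · intro s₂ hs₂ h16'
      have hn : s₂.nat 0 0 0 = I.n := by
        rw [hs₂.nat 0 rfl]; simp [Store.setNat, hs.nat 0 rfl, h.n]
      have h14' : s₂.nat 14 0 0 = j / I.n := by
        rw [hs₂.nat 14 rfl]; simp [Store.setNat, h14]
      have h15' : s₂.nat 15 0 0 = j % I.n := by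
        rw [hs₂.nat 15 rfl]; simp [Store.setNat, h15]
      refine Runs.ite (fun hb => (Runs.setNat ?_).mono (Nat.le_succ 1) fun _ h => h)
        (fun hb => Runs.seq (Runs.setNat (Runs.setNat ?_))) <;>
        simp only [BExpr.Holds, NExpr.eval, hn, h15', not_lt] at hb <;>
        simp [Store.setNat, NExpr.eval, h14', h15'] <;>
        refine ⟨?_, ?_, fun x hx => h16' x (by omega)⟩
      · rw [Nat.succ_div_of_not_dvd]
        rw [Nat.dvd_iff_mod_eq_zero, Nat.add_mod, Nat.mod_eq_of_lt (a := 1) (by omega),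
          Nat.mod_eq_of_lt hb]
        omega
      · rw [Nat.add_mod, Nat.mod_eq_of_lt (a := 1) (by omega), Nat.mod_eq_of_lt hb]
      · have := Nat.mod_lt j I.n_pos
        rw [Nat.succ_div_of_dvd]
        rw [Nat.dvd_iff_mod_eq_zero, ← Nat.mod_add_mod]
        rw [show j % I.n + 1 = I.n by omega, Nat.mod_self]
      · have := Nat.mod_lt j I.n_pos
        rw [← Nat.mod_add_mod, show j % I.n + 1 = I.n by omega, Nat.mod_self]

theorem runs_progBig (h : Base I s) :
    Runs progBig s (1 + (I.n * (1 + 2) + 2)) (fun s' => s'.rat 1 0 0 = I.big) := by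
  refine Runs.seq (Runs.setRat ?_)
  refine Runs.forLoop (fun j s => s.rat 1 0 0 = 1 + ∑ v ∈ Finset.range j, I.matrix I.root v)
    (by rfl) ?_ ?_ ?_
  · intro s' hs
    simp [NExpr.eval, hs.nat 0 rfl, Store.setRat, h.n]
  · simp [Store.setRat, Store.setNat, RExpr.eval, NExpr.eval]
  · intro j hj s₁ hs h9 h1
    refine Runs.setRat ?_
    have h0 : s₁.rat 0 = I.matrix := by
      rw [hs.rat 0 rfl]; simp [Store.setRat, h.matrix]
    have h2 : s₁.nat 2 0 0 = I.root := by
      rw [hs.nat 2 rfl]; simp [Store.setRat, h.root]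
    simp [Store.setRat, Store.setNat, RExpr.eval, NExpr.eval, h1, h0, h2, h9,
      Finset.sum_range_succ, add_assoc]

/-! ### The metric and the elimination order -/

namespace Problem

variable (I)

theorem matrix_of_lt {u v : ℕ} (hu : u < I.n) (hv : v < I.n) :
    I.matrix u v = I.dist ⟨u, hu⟩ ⟨v, hv⟩ := by
  simp [matrix, hu, hv]

theorem matrix_fin (u v : Fin I.n) : I.matrix u v = I.dist u v := by
  rw [I.matrix_of_lt u.2 v.2]

theorem matrix_comm (u v : ℕ) : I.matrix u v = I.matrix v u := by
  by_cases h : u < I.n ∧ v < I.n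
  · rw [I.matrix_of_lt h.1 h.2, I.matrix_of_lt h.2 h.1, I.dist_comm]
  · rw [matrix, matrix, dif_neg h, dif_neg (by tauto)]

theorem matrix_triangle {u v w : ℕ} (hu : u < I.n) (hv : v < I.n) (hw : w < I.n) :
    I.matrix u w ≤ I.matrix u v + I.matrix v w := by
  rw [I.matrix_of_lt hu hv, I.matrix_of_lt hv hw, I.matrix_of_lt hu hw]
  exact I.dist_triangle _ _ _

theorem matrix_self (u : ℕ) : I.matrix u u = 0 := by
  by_cases h : u < I.n
  · rw [I.matrix_of_lt h h, I.dist_eq_zero]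
  · rw [matrix, dif_neg (by tauto)]

theorem dist_nonneg (u v : Fin I.n) : 0 ≤ I.dist u v := by
  have h := I.dist_triangle u v u
  rw [(I.dist_eq_zero u u).2 rfl, I.dist_comm v u] at h
  linarith

theorem dist_pos {u v : Fin I.n} (h : u ≠ v) : 0 < I.dist u v :=
  (I.dist_nonneg u v).lt_of_ne fun h' => h ((I.dist_eq_zero u v).1 h'.symm)

theorem matrix_nonneg (u v : ℕ) : 0 ≤ I.matrix u v := by
  by_cases h : u < I.n ∧ v < I.n
  · rw [I.matrix_of_lt h.1 h.2]
    exact I.dist_nonneg _ _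
  · rw [matrix, dif_neg h]

theorem matrix_pos {u v : ℕ} (hu : u < I.n) (hv : v < I.n) (h : u ≠ v) : 0 < I.matrix u v := by
  rw [I.matrix_of_lt hu hv]
  exact I.dist_pos (by simpa using h)

theorem big_pos : 0 < I.big := by
  have : 0 ≤ ∑ v ∈ Finset.range I.n, I.matrix I.root v :=
    Finset.sum_nonneg fun v _ => I.matrix_nonneg _ _
  rw [big]
  linarith

theorem Before.trans {I : Problem} {u v w : ℕ} (h : I.Before u v) (h' : I.Before v w) :
    I.Before u w := by
  rcases h with h | ⟨h, h₁⟩ <;> rcases h' with h' | ⟨h', h₂⟩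
  · exact Or.inl (h'.trans h)
  · exact Or.inl ((not_lt.1 h').trans_lt h)
  · exact Or.inl (h'.trans_le (not_lt.1 h))
  · exact Or.inr ⟨not_lt.2 ((not_lt.1 h').trans (not_lt.1 h)), h₁.trans h₂⟩

theorem not_before_self (v : ℕ) : ¬ I.Before v v := by simp [Before]

theorem before_or_before {u v : ℕ} (h : u ≠ v) : I.Before u v ∨ I.Before v u := by
  unfold Before
  rcases lt_trichotomy (I.matrix I.root u) (I.matrix I.root v) with h' | h' | h'
  · exact Or.inr (Or.inl h')
  · rcases lt_or_gt_of_ne h with h'' | h'' <;> simp [h', h'']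
  · exact Or.inl (Or.inl h')

theorem rank_lt_rank {u v : ℕ} (hu : u < I.n) (h : I.Before u v) : I.rank u < I.rank v := by
  refine Finset.card_lt_card ((Finset.ssubset_iff_of_subset ?_).2 ⟨u, ?_, ?_⟩)
  · intro w
    simp only [Finset.mem_filter]
    exact fun hw => ⟨hw.1, hw.2.trans h⟩
  · simp [hu, h]
  · simp [I.not_before_self]

theorem rank_injOn : Set.InjOn I.rank (Finset.range I.n : Set ℕ) := by
  intro u hu v hv huv
  simp only [Finset.coe_range, Set.mem_Iio] at hu hv
  by_contra h
  rcases I.before_or_before h with h | h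
  · exact (I.rank_lt_rank hu h).ne huv
  · exact (I.rank_lt_rank hv h).ne huv.symm

theorem rank_lt {v : ℕ} (hv : v < I.n) : I.rank v < I.n := by
  classical
  refine (Finset.card_lt_card (Finset.filter_ssubset.2 ⟨v, ?_, ?_⟩)).trans_eq
    (Finset.card_range I.n)
  · simpa using hv
  · exact I.not_before_self v

theorem exists_rank_eq {j : ℕ} (hj : j < I.n) : ∃ v < I.n, I.rank v = j := by
  have h := Finset.eq_of_subset_of_card_le
    (s := (Finset.range I.n).image I.rank) (t := Finset.range I.n)
    (fun x hx => by
      obtain ⟨v, hv, rfl⟩ := Finset.mem_image.1 hx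
      simpa using I.rank_lt (by simpa using hv))
    (Finset.card_image_of_injOn I.rank_injOn).ge
  have : j ∈ (Finset.range I.n).image I.rank := by rw [h]; simpa using hj
  obtain ⟨v, hv, hvj⟩ := Finset.mem_image.1 this
  exact ⟨v, by simpa using hv, hvj⟩

variable {I}

/-- The parent is strictly closer to the root, hence is eliminated later. -/
theorem IsParent.rank_lt {v p : ℕ} (hv : v < I.n) (h : I.IsParent v p) : I.rank v < I.rank p := by
  refine I.rank_lt_rank hv (Or.inl ?_)
  rw [h.between]
  linarith [I.matrix_pos h.lt hv h.ne]

end Problem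

theorem runs_progOrder (h : Base I s) :
    Runs progOrder s (I.n * ((1 + ((I.n * ((1 + 1) + 2) + 2) + 1)) + 2) + 2)
      (fun s' => ∀ v < I.n, s'.nat 17 (I.rank v) 0 = v) := by
  classical
  refine Runs.forLoop (fun j s => ∀ v < j, s.nat 17 (I.rank v) 0 = v) (by rfl) ?_ ?_ ?_
  · intro s' hs
    simp [NExpr.eval, hs.nat 0 rfl, h.n]
  · simp
  · intro v hv s₁ hs h9 h17
    have hb := h.agree hs rfl
    refine Runs.seq (Runs.setNat ?_)
    refine Runs.seq' (R := fun s => s.nat 23 0 0 = I.rank v) ?_ ?_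
    · refine Runs.forLoop (fun i s => s.nat 23 0 0 =
        ((Finset.range i).filter (I.Before · v)).card) (by rfl) ?_ ?_ ?_
      · intro s' hs'
        simp [NExpr.eval, hs'.nat 0 rfl, Store.setNat, hb.n]
      · simp [Store.setNat, NExpr.eval]
      · intro u hu s₂ hs₂ h10 h23
        have h0 : s₂.rat 0 = I.matrix := by
          rw [hs₂.rat 0 rfl]; simp [Store.setNat, hb.matrix]
        have h2 : s₂.nat 2 0 0 = I.root := by
          rw [hs₂.nat 2 rfl]; simp [Store.setNat, hb.root]
        have h9' : s₂.nat 9 0 0 = v := by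
          rw [hs₂.nat 9 rfl]; simp [Store.setNat, h9]
        refine Runs.ite (fun hb => Runs.setNat ?_) (fun hb => Runs.skip ?_) <;>
          simp only [BExpr.Holds, NExpr.eval, RExpr.eval, h0, h2, h9', h10] at hb
        · have : I.Before u v := by unfold Problem.Before; tauto
          simp [Store.setNat, NExpr.eval, h23, Finset.range_add_one, Finset.filter_insert, this]
        · have : ¬ I.Before u v := by unfold Problem.Before; tauto
          simp [Store.setNat, h23, Finset.range_add_one, Finset.filter_insert, this]
    · intro s₂ hs₂ h23
      refine Runs.setNat ?_
      have h9' : s₂.nat 9 0 0 = v := by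
        rw [hs₂.nat 9 rfl]; simp [Store.setNat, h9]
      intro w hw
      simp only [Store.setNat, NExpr.eval, h9', h23]
      by_cases hwv : w = v
      · simp [hwv]
      · have : I.rank w ≠ I.rank v := fun h' =>
          hwv (I.rank_injOn (by simp; omega) (by simpa using hv) h')
        simp [this, hs₂.nat 17 rfl, Store.setNat, h17 w (by omega)]

theorem runs_progParents (h : Base I s) :
    Runs progParents s ((I.n * ((1 + ((I.n * ((1 + 1) + 2) + 2) + 1)) + 2) + 2) + 1)
      (fun s' => I.IsParentMap fun v => s'.nat 18 v 0) := by
  refine Runs.seq' (R := fun s => ∀ v < I.n, v ≠ I.root → I.IsParent v (s.nat 18 v 0)) ?_ ?_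
  · refine Runs.forLoop (fun j s => ∀ v < j, v ≠ I.root → I.IsParent v (s.nat 18 v 0))
      (by rfl) ?_ ?_ ?_
    · intro s' hs
      simp [NExpr.eval, hs.nat 0 rfl, h.n]
    · simp
    · intro v hv s₁ hs h9 h18
      have hb := h.agree hs rfl
      refine Runs.seq (Runs.setNat ?_)
      refine Runs.seq' (R := fun s => v ≠ I.root → I.IsParent v (s.nat 23 0 0)) ?_ ?_
      -- The search starts with the root as candidate. It is meaningless for `v = I.root`, whose
      -- entry is overwritten afterwards.
      · refine (Runs.forLoop (m := I.n) (fun i s => v ≠ I.root → s.nat 23 0 0 < I.n ∧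
          s.nat 23 0 0 ≠ v ∧
          I.matrix I.root v = I.matrix I.root (s.nat 23 0 0) + I.matrix (s.nat 23 0 0) v ∧
          ∀ u < i, u ≠ v → I.matrix I.root v = I.matrix I.root u + I.matrix u v →
            I.matrix (s.nat 23 0 0) v ≤ I.matrix u v) (by rfl) ?_ ?_ ?_).mono le_rfl ?_
        · intro s' hs'
          simp [NExpr.eval, hs'.nat 0 rfl, Store.setNat, hb.n]
        · intro hvr
          simp [Store.setNat, NExpr.eval, hb.root, I.matrix_self, hvr.symm]
        · intro u hu s₂ hs₂ h10 hI
          have h0 : s₂.rat 0 = I.matrix := by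
            rw [hs₂.rat 0 rfl]; simp [Store.setNat, hb.matrix]
          have h2 : s₂.nat 2 0 0 = I.root := by
            rw [hs₂.nat 2 rfl]; simp [Store.setNat, hb.root]
          have h9' : s₂.nat 9 0 0 = v := by
            rw [hs₂.nat 9 rfl]; simp [Store.setNat, h9]
          have ht := I.matrix_triangle I.root.2 hu hv
          refine Runs.ite (fun hc => Runs.setNat ?_) (fun hc => Runs.skip ?_) <;>
            simp only [BExpr.Holds, BExpr.holds_nne, NExpr.eval, RExpr.eval, h0, h2, h9', h10,
              not_lt] at hc <;> intro hvr <;> obtain ⟨h₁, h₂, h₃, h₄⟩ := hI hvr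
          · simp only [Store.setNat, NExpr.eval, h10]
            refine ⟨hu, hc.1, le_antisymm ht hc.2.1, ?_⟩
            intro w hw hwv hwb
            simp
            by_cases hwu : w = u
            · rw [hwu]
            · exact hc.2.2.le.trans (h₄ w (by omega) hwv hwb)
          · refine ⟨h₁, h₂, h₃, ?_⟩
            intro w hw hwv hwb
            by_cases hwu : w = u
            · subst hwu
              by_contra hlt
              exact hc ⟨hwv, hwb.ge, not_le.1 hlt⟩
            · exact h₄ w (by omega) hwv hwb
        · intro s' hs' hvr
          obtain ⟨h₁, h₂, h₃, h₄⟩ := hs' hvr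
          exact ⟨h₁, h₂, h₃, h₄⟩
      · intro s₂ hs₂ h23
        refine Runs.setNat ?_
        have h9' : s₂.nat 9 0 0 = v := by
          rw [hs₂.nat 9 rfl]; simp [Store.setNat, h9]
        intro w hw hwr
        simp only [Store.setNat, NExpr.eval, h9']
        by_cases hwv : w = v
        · subst hwv
          simpa using h23 hwr
        · simpa [hwv, hs₂.nat 18 rfl, Store.setNat] using h18 w (by omega) hwr
  · intro s' hs' h18
    have hb := h.agree hs' rfl
    refine Runs.setNat ⟨?_, ?_⟩
    · simp [Store.setNat, NExpr.eval, hb.root, hb.n]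
    · intro v hv hvr
      simpa [Store.setNat, NExpr.eval, hb.root, hvr] using h18 v hv hvr

/-- Row `I.n` of the cost table belongs to the fictitious parent of the root; it must start at zero,
since the elimination of the root adds the optimum there. -/
theorem runs_progCosts (h : Base I s) (h6 : s.nat 6 0 0 = I.levels)
    (h7 : s.nat 7 0 0 = I.numStates) (h1 : s.rat 1 0 0 = I.big)
    (h16 : ∀ x < I.numStates, ∀ i < I.levels, s.nat 16 x i = I.digit x i)
    (h2 : ∀ x, s.rat 2 I.n x = 0) :
    Runs progCosts s (I.n * ((I.numStates *
        ((1 + ((I.levels * ((1 + 1) + 2) + 2) + (1 + (1 + 1 + 1 + 1)))) + 2) + 2) + 2) + 2)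
      (fun s' => (∀ v < I.n, ∀ x < I.numStates, s'.nat 19 v x = I.label v x ∧
        s'.rat 2 v x = I.vertexCost v x) ∧ ∀ x, s'.rat 2 I.n x = 0) := by
  refine Runs.forLoop (fun j s => (∀ v < j, ∀ x < I.numStates, s.nat 19 v x = I.label v x ∧
        s.rat 2 v x = I.vertexCost v x) ∧ ∀ x, s.rat 2 I.n x = 0) (by rfl) ?_ ?_ ?_
  · intro s' hs
    simp [NExpr.eval, hs.nat 0 rfl, h.n]
  · simpa [Store.setNat] using h2
  rintro v hv s₁ hs h9 ⟨hI, hz⟩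
  refine (Runs.forLoop (m := I.numStates) (fun j s => (∀ v' x, x < I.numStates →
      v' < v ∨ (v' = v ∧ x < j) → s.nat 19 v' x = I.label v' x ∧
        s.rat 2 v' x = I.vertexCost v' x) ∧ ∀ x, s.rat 2 I.n x = 0)
      (by rfl) ?_ ?_ ?_).mono le_rfl ?_
  · intro s' hs'
    simp [NExpr.eval, hs'.nat 7 rfl, hs.nat 7 rfl, h7]
  · refine ⟨fun v' x hx hv' => ?_, hz⟩
    simpa [Store.setNat] using hI v' (by omega) x hx
  · rintro x hx s₂ hs₂ h10 ⟨hI', hz'⟩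
    have hb := (h.agree hs rfl).agree hs₂ rfl
    have e16 : ∀ i < I.levels, s₂.nat 16 x i = I.digit x i := fun i hi => by
      rw [hs₂.nat 16 rfl, hs.nat 16 rfl, h16 x hx i hi]
    have e6 : s₂.nat 6 0 0 = I.levels := by rw [hs₂.nat 6 rfl, hs.nat 6 rfl, h6]
    have e1 : s₂.rat 1 0 0 = I.big := by rw [hs₂.rat 1 rfl, hs.rat 1 rfl, h1]
    have e9 : s₂.nat 9 0 0 = v := by rw [hs₂.nat 9 rfl, h9]
    clear hs₂ hs
    refine Runs.seq (Runs.setNat ?_)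
    refine Runs.seq' (R := fun s => s.nat 23 0 0 = I.label v x) ?_ ?_
    · refine Runs.forLoop (fun m s => s.nat 23 0 0 = I.labelBelow v x m) (by rfl) ?_ ?_ ?_
      · intro s' hs'
        simp [NExpr.eval, hs'.nat 6 rfl, Store.setNat, e6]
      · simp [Store.setNat, NExpr.eval, Problem.labelBelow]
      · intro i hi s₃ hs₃ h11 h23
        have e16' : s₃.nat 16 x i = I.digit x i := by
          rw [hs₃.nat 16 rfl]; simp [Store.setNat, e16 i hi]
        have e9' : s₃.nat 9 0 0 = v := by rw [hs₃.nat 9 rfl]; simp [Store.setNat, e9]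
        have e10' : s₃.nat 10 0 0 = x := by rw [hs₃.nat 10 rfl]; simp [Store.setNat, h10]
        refine Runs.ite (fun hc => Runs.setNat ?_) (fun hc => Runs.skip ?_) <;>
          simp only [BExpr.Holds, BExpr.holds_nne, NExpr.eval, h11, h23, e10', e9', e16',
            not_not] at hc
        · simp [Store.setNat, NExpr.eval, h11, Problem.labelBelow, hc]
        · rw [Problem.labelBelow, if_neg hc]
          simpa [Store.setNat] using h23
    · intro s₃ hs₃ h23
      have e16' : ∀ i < I.levels, s₃.nat 16 x i = I.digit x i := fun i hi => by
        rw [hs₃.nat 16 rfl]; simp [Store.setNat, e16 i hi]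
      have e9' : s₃.nat 9 0 0 = v := by rw [hs₃.nat 9 rfl]; simp [Store.setNat, e9]
      have e10' : s₃.nat 10 0 0 = x := by rw [hs₃.nat 10 rfl]; simp [Store.setNat, h10]
      have e6' : s₃.nat 6 0 0 = I.levels := by rw [hs₃.nat 6 rfl]; simp [Store.setNat, e6]
      have e1' : s₃.rat 1 0 0 = I.big := by rw [hs₃.rat 1 rfl]; simp [Store.setNat, e1]
      have e0' : s₃.rat 0 = I.matrix := by rw [hs₃.rat 0 rfl]; simp [Store.setNat, hb.matrix]
      have e2' : s₃.nat 2 0 0 = I.root := by rw [hs₃.nat 2 rfl]; simp [Store.setNat, hb.root]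
      have e3' : 0 < s₃.nat 3 v 0 ↔ I.IsTerminal v := by
        rw [hs₃.nat 3 rfl, ← hb.terminals v]; simp [Store.setNat]
      have f19 : s₃.nat 19 = s₂.nat 19 := by rw [hs₃.nat 19 rfl]; simp [Store.setNat]
      have f2 : s₃.rat 2 = s₂.rat 2 := by rw [hs₃.rat 2 rfl]; simp [Store.setNat]
      clear hs₃
      have hl : 0 < I.levels := Nat.succ_pos _
      refine Runs.seq (Runs.setNat ?_)
      simp only [NExpr.eval, e9', e10', h23]
      -- Each of the five branches writes a single entry of the cost table; `leaf` leaves only the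
      -- check of its position and value.
      have leaf : ∀ a b c, a = v → b = x → c = I.vertexCost v x → ∀ s₄, s₄ =
          (((s₃.setNat 19 v x (I.label v x)).setRat 2 a b c).setNat 10 0 0 (x + 1)) →
          (∀ v' y, y < I.numStates →
      v' < v ∨ (v' = v ∧ y < x + 1) → s₄.nat 19 v' y = I.label v' y ∧
        s₄.rat 2 v' y = I.vertexCost v' y) ∧ ∀ x, s₄.rat 2 I.n x = 0 := by
        intro a b c ha hb' hc s₄ hs₄
        rw [ha, hb'] at hs₄
        subst hs₄
        refine ⟨fun v' y hy hv' => ?_, fun y => ?_⟩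
        · by_cases hxy : v' = v ∧ y = x
          · simp [Store.setNat, Store.setRat, hxy, hc]
          · simpa [Store.setNat, Store.setRat, hxy, f19, f2] using hI' v' y hy (by omega)
        · simpa [Store.setNat, Store.setRat, hv.ne', f2] using hz' y
      refine Runs.ite (fun hc => (Runs.setRat (leaf _ _ _ ?_ ?_ ?_ _ rfl)).mono (by omega)
          fun _ h => h)
        (fun hc => Runs.ite
          (fun hc' => Runs.ite (fun hc'' => Runs.setRat (leaf _ _ _ ?_ ?_ ?_ _ rfl))
            fun hc'' => Runs.setRat (leaf _ _ _ ?_ ?_ ?_ _ rfl))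
          (fun hc' => Runs.ite (fun hc'' => Runs.setRat (leaf _ _ _ ?_ ?_ ?_ _ rfl))
            fun hc'' => Runs.setRat (leaf _ _ _ ?_ ?_ ?_ _ rfl)))
      all_goals
        clear leaf hI hI' hz hz' hb h h16 e16 f19 f2
        simp [Store.setNat, BExpr.holds_nne, BExpr.Holds, NExpr.eval, RExpr.eval, e9', e10', h23,
          e16' 0 hl, e2', e6', e3', e0', e1'] at *
      all_goals
        try simp [Problem.vertexCost, hc]
      · rw [if_pos hc', if_pos hc'', e16' _ (by omega)]
      · simp [hc'']
        omega
      · rw [if_neg hc'.not_gt, if_pos hc'']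
      · rw [if_neg hc'.not_gt, if_neg hc'']
  · intro s' hs'
    exact ⟨fun v' hv' x hx => hs'.1 v' x hx (by omega), hs'.2⟩

/-! ### The elimination of one point -/

/-- The memory holds the number of levels, the large number and the digits of all states. -/
structure Tables (I : Problem) (s : Store) : Prop extends Base I s where
  levels : s.nat 6 0 0 = I.levels
  states : s.nat 7 0 0 = I.numStates
  big : s.rat 1 0 0 = I.big
  digit : ∀ x < I.numStates, ∀ i < I.levels, s.nat 16 x i = I.digit x i

theorem Tables.agree {p : Prog} {s s' : Store} (h : Tables I s) (ha : Agree p s s')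
    (hp : (p.keepsNat 0 && p.keepsNat 1 && p.keepsNat 2 && p.keepsNat 3 && p.keepsRat 0) = true)
    (hp' : (p.keepsNat 6 && p.keepsNat 7 && p.keepsNat 16 && p.keepsRat 1) = true) :
    Tables I s' := by
  simp only [Bool.and_eq_true] at hp'
  obtain ⟨⟨⟨h6, h7⟩, h16⟩, h1⟩ := hp'
  exact ⟨h.toBase.agree ha hp, by rw [ha.nat 6 h6, h.levels], by rw [ha.nat 7 h7, h.states],
    by rw [ha.rat 1 h1, h.big], by rw [ha.nat 16 h16]; exact h.digit⟩

theorem Tables.setNat (h : Tables I s) {a i j x : ℕ} (ha : 16 < a) :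
    Tables I (s.setNat a i j x) := by
  refine ⟨⟨?_, ?_, ?_, ?_, ?_⟩, ?_, ?_, ?_, ?_⟩
  · simpa [Store.setNat, show 0 ≠ a by omega] using h.n
  · simpa [Store.setNat, show 1 ≠ a by omega] using h.k
  · simpa [Store.setNat, show 2 ≠ a by omega] using h.root
  · simpa [Store.setNat, show 3 ≠ a by omega] using h.terminals
  · simpa [Store.setNat] using h.matrix
  · simpa [Store.setNat, show 6 ≠ a by omega] using h.levels
  · simpa [Store.setNat, show 7 ≠ a by omega] using h.states
  · simpa [Store.setNat] using h.big
  · simpa [Store.setNat, show 16 ≠ a by omega] using h.digit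

theorem Tables.setRat (h : Tables I s) {a i j : ℕ} {x : ℚ} (ha : 1 < a) :
    Tables I (s.setRat a i j x) := by
  refine ⟨⟨h.n, h.k, h.root, h.terminals, ?_⟩, h.levels, h.states, ?_, h.digit⟩
  · simpa [Store.setRat, show 0 ≠ a by omega] using h.matrix
  · simpa [Store.setRat, show 1 ≠ a by omega] using h.big

open Classical in
theorem runs_progValue {v p x y : ℕ} (h : Tables I s) (h24 : s.nat 24 0 0 = v)
    (h25 : s.nat 25 0 0 = p) (h11 : s.nat 11 0 0 = x) (h10 : s.nat 10 0 0 = y)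
    (hx : x < I.numStates) (hy : y < I.numStates) :
    Runs progValue s (1 + (((I.levels * ((1 + 1) + 2) + 2) + 1) + 1))
      (fun s' => s'.rat 4 0 0 = s.rat 2 v x + I.edgePenalty v p x y) := by
  refine Runs.seq (Runs.setRat ?_)
  have h' := h.setRat (a := 4) (i := 0) (j := 0) (x := 0) (by omega)
  refine Runs.seq' (R := fun s' => s'.rat 4 0 0 = I.edgePenalty v p x y) ?_ ?_
  · refine Runs.ite (fun hb => ?_) (fun hb => (Runs.skip ?_).mono (by omega) fun _ h => h)
    · have hvr : v ≠ I.root := by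
        simpa [BExpr.holds_nne, NExpr.eval, Store.setRat, h24, h.root] using hb
      refine (Runs.forLoop (m := I.levels) (fun m s => s.rat 4 0 0 =
        if ∃ i < m, I.Conflict v p x y i then I.big else 0) (by rfl) ?_ ?_ ?_).mono le_rfl ?_
      · intro s' hs'
        simp [NExpr.eval, hs'.nat 6 rfl, Store.setRat, h.levels]
      · simp [Store.setNat, Store.setRat, NExpr.eval, RExpr.eval]
      · intro i hi s₁ hs h12 h4
        have hb := h'.agree hs rfl rfl
        have e24 : s₁.nat 24 0 0 = v := by rw [hs.nat 24 rfl]; exact h24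
        have e25 : s₁.nat 25 0 0 = p := by rw [hs.nat 25 rfl]; exact h25
        have e11 : s₁.nat 11 0 0 = x := by rw [hs.nat 11 rfl]; exact h11
        have e10 : s₁.nat 10 0 0 = y := by rw [hs.nat 10 rfl]; exact h10
        refine Runs.ite (fun hc => Runs.setRat ?_) (fun hc => Runs.skip ?_) <;>
          simp only [BExpr.Holds, BExpr.holds_nne, NExpr.eval, RExpr.eval, e24, e25, e11, e10, h12,
            hb.matrix, hb.digit x hx i hi, hb.digit y hy i hi] at hc
        · have hC : ∃ i' < i + 1, I.Conflict v p x y i' := ⟨i, by omega, hc⟩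
          rw [if_pos hC]
          simp [Store.setNat, Store.setRat, NExpr.eval, RExpr.eval, hb.big]
        · have hC : (∃ i' < i + 1, I.Conflict v p x y i') ↔ ∃ i' < i, I.Conflict v p x y i' := by
            refine ⟨fun ⟨i', hi', hC⟩ => ⟨i', ?_, hC⟩, fun ⟨i', hi', hC⟩ => ⟨i', by omega, hC⟩⟩
            have : i' ≠ i := by rintro rfl; exact hc hC
            omega
          simp only [hC]
          exact h4
      · intro s' hs'
        rw [hs', Problem.edgePenalty]
        simp [hvr]
    · have hvr : v = I.root := by
        simpa [BExpr.holds_nne, NExpr.eval, Store.setRat, h24, h.root] using hb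
      simp [Store.setRat, NExpr.eval, RExpr.eval, Problem.edgePenalty, hvr]
  · intro s₁ hs h4
    have e24 : s₁.nat 24 0 0 = v := by rw [hs.nat 24 rfl]; exact h24
    have e11 : s₁.nat 11 0 0 = x := by rw [hs.nat 11 rfl]; exact h11
    refine Runs.setRat ?_
    simp [NExpr.eval, RExpr.eval, Store.setRat, e24, e11, h4, hs.rat 2 rfl]

theorem Problem.numStates_pos (I : Problem) : 0 < I.numStates := Nat.pow_pos I.n_pos

theorem runs_progBest {v p y : ℕ} (h : Tables I s) (h24 : s.nat 24 0 0 = v)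
    (h25 : s.nat 25 0 0 = p) (h10 : s.nat 10 0 0 = y) (hy : y < I.numStates) :
    Runs progBest s (I.numStates * (((1 + (((I.levels * ((1 + 1) + 2) + 2) + 1) + 1)) +
        ((1 + 1) + 1)) + 2) + 2)
      (fun s' => s'.nat 22 0 0 < I.numStates ∧
        s'.rat 3 0 0 = s.rat 2 v (s'.nat 22 0 0) + I.edgePenalty v p (s'.nat 22 0 0) y ∧
        ∀ x < I.numStates, s'.rat 3 0 0 ≤ s.rat 2 v x + I.edgePenalty v p x y) := by
  refine (Runs.forLoop (m := I.numStates) (fun j s' => (0 < j → s'.nat 22 0 0 < I.numStates ∧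
    s'.rat 3 0 0 = s.rat 2 v (s'.nat 22 0 0) + I.edgePenalty v p (s'.nat 22 0 0) y) ∧
    ∀ x < j, s'.rat 3 0 0 ≤ s.rat 2 v x + I.edgePenalty v p x y)
    (by rfl) ?_ ?_ ?_).mono le_rfl fun s' hs' => ⟨(hs'.1 I.numStates_pos).1,
      (hs'.1 I.numStates_pos).2, hs'.2⟩
  · intro s' hs'
    simp [NExpr.eval, hs'.nat 7 rfl, h.states]
  · simp
  rintro x hx s₁ hs h11 ⟨hI, hI'⟩
  refine Runs.seq' (runs_progValue (h.agree hs rfl rfl) (by rw [hs.nat 24 rfl, h24])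
    (by rw [hs.nat 25 rfl, h25]) h11 (by rw [hs.nat 10 rfl, h10]) hx hy) ?_
  intro s₂ hs₂ h4
  rw [hs.rat 2 rfl] at h4
  have e11 : s₂.nat 11 0 0 = x := by rw [hs₂.nat 11 rfl, h11]
  have e22 : s₂.nat 22 = s₁.nat 22 := hs₂.nat 22 rfl
  have e3 : s₂.rat 3 = s₁.rat 3 := hs₂.rat 3 rfl
  refine Runs.ite (fun hc => Runs.seq (Runs.setRat (Runs.setNat ?_)))
    (fun hc => (Runs.skip ?_).mono (by omega) fun _ h => h) <;>
    simp only [BExpr.Holds, NExpr.eval, RExpr.eval, e11, e3] at hc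
  · simp only [Store.setNat, Store.setRat, NExpr.eval, RExpr.eval, h4, e11]
    simp only [Nat.reduceEqDiff, and_self, if_true, false_and, if_false]
    refine ⟨fun _ => ⟨hx, trivial⟩, fun z hz => ?_⟩
    rcases Nat.lt_succ_iff_lt_or_eq.1 hz with hz | rfl
    · have h' : s₂.rat 4 0 0 < s₁.rat 3 0 0 := by
        by_contra h'
        exact hc ⟨by omega, h'⟩
      rw [← h4]
      exact h'.le.trans (hI' z hz)
    · exact le_rfl
  · have hx0 : 0 < x := by
      by_contra hx0
      exact hc fun h' => h'.1 (by omega)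
    have h' : s₁.rat 3 0 0 ≤ s₂.rat 4 0 0 := by
      by_contra h'
      exact hc fun h'' => h''.2 (not_le.1 h')
    simp only [Store.setNat, e3, e22]
    simp only [Nat.reduceEqDiff, false_and, if_false]
    refine ⟨fun _ => hI hx0, fun z hz => ?_⟩
    rcases Nat.lt_succ_iff_lt_or_eq.1 hz with hz | rfl
    · exact hI' z hz
    · rwa [← h4]

theorem runs_progEliminate {v p : ℕ} (h : Tables I s) (h24 : s.nat 24 0 0 = v)
    (h25 : s.nat 25 0 0 = p) (hpv : p ≠ v) :
    Runs progEliminate s (I.numStates * (((I.numStates * (((1 +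
        (((I.levels * ((1 + 1) + 2) + 2) + 1) + 1)) + ((1 + 1) + 1)) + 2) + 2) + (1 + 1)) + 2) + 2)
      (fun s' => (∀ y < I.numStates, s'.nat 20 v y < I.numStates ∧
          (∀ x < I.numStates, s.rat 2 v (s'.nat 20 v y) + I.edgePenalty v p (s'.nat 20 v y) y ≤
            s.rat 2 v x + I.edgePenalty v p x y) ∧
          s'.rat 2 p y = s.rat 2 p y +
            (s.rat 2 v (s'.nat 20 v y) + I.edgePenalty v p (s'.nat 20 v y) y)) ∧
        (∀ u, u ≠ p → s'.rat 2 u = s.rat 2 u) ∧ ∀ u, u ≠ v → s'.nat 20 u = s.nat 20 u) := by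
  refine (Runs.forLoop (m := I.numStates) (fun j s' => (∀ y < j, s'.nat 20 v y < I.numStates ∧
          (∀ x < I.numStates, s.rat 2 v (s'.nat 20 v y) + I.edgePenalty v p (s'.nat 20 v y) y ≤
            s.rat 2 v x + I.edgePenalty v p x y) ∧
          s'.rat 2 p y = s.rat 2 p y +
            (s.rat 2 v (s'.nat 20 v y) + I.edgePenalty v p (s'.nat 20 v y) y)) ∧
        (∀ y, j ≤ y → s'.rat 2 p y = s.rat 2 p y) ∧
        (∀ u, u ≠ p → s'.rat 2 u = s.rat 2 u) ∧ ∀ u, u ≠ v → s'.nat 20 u = s.nat 20 u)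
    (by rfl) ?_ ?_ ?_).mono le_rfl fun s' hs' => ⟨hs'.1, hs'.2.2⟩
  · intro s' hs'
    simp [NExpr.eval, hs'.nat 7 rfl, h.states]
  · simp [Store.setNat]
  rintro y hy s₁ hs h10 ⟨hI, hp, hr, hn⟩
  refine (Runs.seq' (T' := 1 + 1) (runs_progBest (h.agree hs rfl rfl)
    (by rw [hs.nat 24 rfl, h24]) (by rw [hs.nat 25 rfl, h25]) h10 hy) ?_).mono le_rfl fun _ h => h
  rintro s₂ hs₂ ⟨h22, h3, h3'⟩
  -- Row `v` still holds its initial costs, as only row `p ≠ v` is being changed.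
  rw [hr v hpv.symm] at h3 h3'
  have e10 : s₂.nat 10 0 0 = y := by rw [hs₂.nat 10 rfl, h10]
  have e24 : s₂.nat 24 0 0 = v := by rw [hs₂.nat 24 rfl, hs.nat 24 rfl, h24]
  have e25 : s₂.nat 25 0 0 = p := by rw [hs₂.nat 25 rfl, hs.nat 25 rfl, h25]
  have e2 : s₂.rat 2 = s₁.rat 2 := hs₂.rat 2 rfl
  have e20 : s₂.nat 20 = s₁.nat 20 := hs₂.nat 20 rfl
  refine Runs.seq (Runs.setRat (Runs.setNat ?_))
  simp only [Store.setNat, Store.setRat, NExpr.eval, RExpr.eval, e10, e24, e25, e2, e20,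
    Nat.reduceEqDiff, false_and, if_false, true_and]
  refine ⟨fun z hz => ?_, fun z hz => ?_, fun u hu => ?_, fun u hu => ?_⟩
  · by_cases hzy : z = y
    · subst hzy
      simp only [if_true]
      rw [← h3]
      exact ⟨h22, h3', by rw [hp z le_rfl]⟩
    · simpa [hzy] using hI z (by omega)
  · simpa [show z ≠ y by omega] using hp z (by omega)
  · simpa [hu] using hr u hu
  · simpa [hu] using hn u hu

/-! ### The elimination of all points and the choice of states -/

namespace Problem

variable {par : ℕ → ℕ}

theorem IsParentMap.lt_rank (hp : I.IsParentMap par) {v : ℕ} (hv : v < I.n) :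
    par v = I.n ∨ par v < I.n ∧ I.rank v < I.rank (par v) := by
  by_cases h : v = I.root
  · exact Or.inl (h ▸ hp.root)
  · exact Or.inr ⟨(hp.isParent v hv h).lt, (hp.isParent v hv h).rank_lt hv⟩

/-- The points that have not been eliminated in the first `j` rounds. -/
noncomputable def remaining (I : Problem) (j : ℕ) : Finset ℕ :=
  (Finset.range I.n).filter (j ≤ I.rank ·)

/-- The cost of an assignment when the points in `R` remain and `M` is the table of their costs. -/
noncomputable def partialCost (I : Problem) (par : ℕ → ℕ) (M : ℕ → ℕ → ℚ) (R : Finset ℕ)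
    (σ : ℕ → ℕ) : ℚ :=
  ∑ u ∈ R, (M u (σ u) + I.edgePenalty u (par u) (σ u) (σ (par u))) + M I.n (σ I.n)

theorem mem_remaining {j u : ℕ} : u ∈ I.remaining j ↔ u < I.n ∧ j ≤ I.rank u := by
  simp [remaining]

theorem remaining_eq_insert {v : ℕ} (hv : v < I.n) :
    I.remaining (I.rank v) = insert v (I.remaining (I.rank v + 1)) := by
  ext u
  simp only [mem_remaining, Finset.mem_insert]
  constructor
  · rintro ⟨hu, h⟩
    rcases h.eq_or_lt with h | h
    · exact Or.inl (I.rank_injOn (by simpa using hu) (by simpa using hv) h.symm)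
    · exact Or.inr ⟨hu, h⟩
  · rintro (rfl | ⟨hu, h⟩)
    · exact ⟨hv, le_rfl⟩
    · exact ⟨hu, by omega⟩

/-- The row of `par v` is either that of a remaining point or the sentinel row `I.n`, so `c` enters
the partial cost exactly once. -/
theorem partialCost_eliminate (hp : I.IsParentMap par) {v : ℕ} (hv : v < I.n)
    {M M' : ℕ → ℕ → ℚ} {σ : ℕ → ℕ} {c : ℚ} (hM : ∀ u, u ≠ par v → M' u = M u)
    (hM' : M' (par v) (σ (par v)) = M (par v) (σ (par v)) + c) :
    I.partialCost par M' (I.remaining (I.rank v + 1)) σ +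
        (M v (σ v) + I.edgePenalty v (par v) (σ v) (σ (par v))) =
      I.partialCost par M (I.remaining (I.rank v)) σ + c := by
  have hM'' : ∀ u, M' u (σ u) = M u (σ u) + if u = par v then c else 0 := by
    intro u
    by_cases hu : u = par v
    · rw [hu, hM']; simp
    · simp [hM u hu, hu]
  have hvm : v ∉ I.remaining (I.rank v + 1) := by simp [mem_remaining]
  have hsum : (∑ u ∈ I.remaining (I.rank v + 1), if u = par v then c else 0) +
      (if I.n = par v then c else 0) = c := by
    rw [Finset.sum_ite_eq']
    rcases hp.lt_rank hv with h | ⟨h, h'⟩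
    · simp only [h, if_true, add_eq_right, ite_eq_right_iff]
      exact fun hm => absurd (mem_remaining.1 hm).1 (lt_irrefl _)
    · have : par v ∈ I.remaining (I.rank v + 1) := mem_remaining.2 ⟨h, h'⟩
      simp [this, h.ne']
  simp only [partialCost, hM'', remaining_eq_insert hv, Finset.sum_insert hvm]
  have : ∀ u, M u (σ u) + (if u = par v then c else 0) +
      I.edgePenalty u (par u) (σ u) (σ (par u)) =
      (M u (σ u) + I.edgePenalty u (par u) (σ u) (σ (par u))) +
        (if u = par v then c else 0) := fun u => by ring
  simp only [this, Finset.sum_add_distrib] at hsum ⊢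
  linarith

end Problem

/-- The invariant fixes an assignment `σ` and compares its partial with its total cost: elimination
never raises the partial cost above the total, and keeps equality if `σ` follows the recorded
minimisers. At the end only the entry in row `I.n` is left, a lower bound that the recorded choice
attains. -/
theorem runs_progEliminateAll {par : ℕ → ℕ} (h : Tables I s) (hp : I.IsParentMap par)
    (h18 : ∀ v, s.nat 18 v 0 = par v) (h17 : ∀ v < I.n, s.nat 17 (I.rank v) 0 = v)
    (h2 : ∀ v < I.n, ∀ x < I.numStates, s.rat 2 v x = I.vertexCost v x)
    (hz : ∀ x, s.rat 2 I.n x = 0) :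
    Runs progEliminateAll s (I.n * ((1 + (1 + (I.numStates * (((I.numStates * (((1 +
        (((I.levels * ((1 + 1) + 2) + 2) + 1) + 1)) + ((1 + 1) + 1)) + 2) + 2) + (1 + 1)) + 2)
        + 2))) + 2) + 2)
      (fun s' => (∀ v < I.n, ∀ y < I.numStates, s'.nat 20 v y < I.numStates) ∧
        ∀ σ : ℕ → ℕ, (∀ v ≤ I.n, σ v < I.numStates) →
          s'.rat 2 I.n (σ I.n) ≤ I.totalCost par σ ∧
          ((∀ v < I.n, σ v = s'.nat 20 v (σ (par v))) →
            s'.rat 2 I.n (σ I.n) = I.totalCost par σ)) := by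
  refine (Runs.forLoop (m := I.n) (fun j s' =>
      (∀ v < I.n, I.rank v < j → ∀ y < I.numStates, s'.nat 20 v y < I.numStates) ∧
        ∀ σ : ℕ → ℕ, (∀ v ≤ I.n, σ v < I.numStates) →
          I.partialCost par (s'.rat 2) (I.remaining j) σ ≤ I.totalCost par σ ∧
          ((∀ v < I.n, I.rank v < j → σ v = s'.nat 20 v (σ (par v))) →
            I.partialCost par (s'.rat 2) (I.remaining j) σ = I.totalCost par σ))
    (by rfl) ?_ ?_ ?_).mono le_rfl ?_
  · intro s' hs'
    simp [NExpr.eval, hs'.nat 0 rfl, h.n]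
  · refine ⟨by simp, fun σ hσ => ?_⟩
    have : I.partialCost par ((s.setNat 9 0 0 0).rat 2) (I.remaining 0) σ = I.totalCost par σ := by
      simp only [Problem.partialCost, Problem.totalCost, Problem.remaining, Store.setNat, hz]
      simp only [Nat.zero_le, Finset.filter_true, add_zero]
      refine Finset.sum_congr rfl fun v hv => ?_
      have hv := Finset.mem_range.1 hv
      rw [h2 v hv _ (hσ v hv.le)]
    exact ⟨this.le, fun _ => this⟩
  · rintro j hj s₁ hs h9 ⟨hI, hI'⟩
    obtain ⟨v, hv, rfl⟩ := I.exists_rank_eq hj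
    have hpv : par v ≠ v := by
      rcases hp.lt_rank hv with h' | ⟨_, h'⟩
      · omega
      · intro h''; rw [h''] at h'; exact lt_irrefl _ h'
    have e17 : s₁.nat 17 (I.rank v) 0 = v := by rw [hs.nat 17 rfl, h17 v hv]
    have e18 : s₁.nat 18 v 0 = par v := by rw [hs.nat 18 rfl, h18 v]
    refine Runs.seq (Runs.setNat (Runs.seq (Runs.setNat ?_)))
    refine (runs_progEliminate (v := v) (p := par v)
      (((h.agree hs rfl rfl).setNat (by omega)).setNat (by omega)) ?_ ?_ hpv).mono le_rfl ?_
    · simp [Store.setNat, NExpr.eval, h9, e17]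
    · simp [Store.setNat, NExpr.eval, h9, e17, e18]
    rintro s₂ ⟨h₁, h₂, h₃⟩
    simp only [Store.setNat, Nat.reduceEqDiff, false_and, if_false] at h₁ h₂ h₃ ⊢
    refine ⟨fun u hu hur y hy => ?_, fun σ hσ => ?_⟩
    · by_cases huv : u = v
      · rw [huv]; exact (h₁ y hy).1
      · rw [h₃ u huv]
        have : I.rank u ≠ I.rank v := fun h' =>
          huv (I.rank_injOn (by simpa using hu) (by simpa using hv) h')
        exact hI u hu (by omega) y hy
    · have hpn : par v ≤ I.n := by
        rcases hp.lt_rank hv with h' | ⟨h', _⟩ <;> omega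
      have hσp := hσ _ hpn
      have hcost := Problem.partialCost_eliminate hp hv h₂ (h₁ _ hσp).2.2
      have hmin := (h₁ _ hσp).2.1 _ (hσ v hv.le)
      refine ⟨by linarith [(hI' σ hσ).1], fun hcons => ?_⟩
      have hc := (hI' σ hσ).2 fun u hu hur => by
        rw [hcons u hu (by omega), h₃ u]
        rintro rfl
        exact lt_irrefl _ hur
      rw [← hcons v hv (by omega)] at hcost
      linarith
  · rintro s' ⟨h₁, h₂⟩
    refine ⟨fun v hv => h₁ v hv (I.rank_lt hv), fun σ hσ => ?_⟩
    have : I.remaining I.n = ∅ := by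
      ext u
      simp only [Problem.mem_remaining, Finset.notMem_empty, iff_false, not_and, not_le]
      exact fun hu => I.rank_lt hu
    have h' := h₂ σ hσ
    simp only [Problem.partialCost, this, Finset.sum_empty, zero_add] at h'
    exact ⟨h'.1, fun hc => h'.2 fun v hv _ => hc v hv⟩

theorem runs_progChoose {par : ℕ → ℕ} (h : Base I s) (hp : I.IsParentMap par)
    (h18 : ∀ v, s.nat 18 v 0 = par v) (h17 : ∀ v < I.n, s.nat 17 (I.rank v) 0 = v)
    (h20 : ∀ v < I.n, ∀ y < I.numStates, s.nat 20 v y < I.numStates)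
    (h21 : s.nat 21 I.n 0 = 0) :
    Runs progChoose s (I.n * ((1 + 1) + 2) + 2)
      (fun s' => (∀ v ≤ I.n, s'.nat 21 v 0 < I.numStates) ∧
        ∀ v < I.n, s'.nat 21 v 0 = s.nat 20 v (s'.nat 21 (par v) 0)) := by
  refine (Runs.forLoop (m := I.n) (fun j s' => s'.nat 21 I.n 0 = 0 ∧
      ∀ v < I.n, I.n ≤ I.rank v + j → s'.nat 21 v 0 < I.numStates ∧
        s'.nat 21 v 0 = s.nat 20 v (s'.nat 21 (par v) 0)) (by rfl) ?_ ?_ ?_).mono le_rfl ?_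
  · intro s' hs'
    simp [NExpr.eval, hs'.nat 0 rfl, h.n]
  · refine ⟨by simpa [Store.setNat] using h21, fun v hv hv' => ?_⟩
    have := I.rank_lt hv
    omega
  · rintro j hj s₁ hs h9 ⟨hz, hI⟩
    obtain ⟨v, hv, hvj⟩ := I.exists_rank_eq (j := I.n - 1 - j) (by omega)
    have hb := h.agree hs rfl
    have hpv : par v ≠ v := by
      rcases hp.lt_rank hv with h' | ⟨_, h'⟩
      · omega
      · intro h''; rw [h''] at h'; exact lt_irrefl _ h'
    have e17 : s₁.nat 17 (I.n - 1 - j) 0 = v := by rw [hs.nat 17 rfl, ← hvj, h17 v hv]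
    have e18 : s₁.nat 18 v 0 = par v := by rw [hs.nat 18 rfl, h18 v]
    have e20 : s₁.nat 20 = s.nat 20 := hs.nat 20 rfl
    have hσp : s₁.nat 21 (par v) 0 < I.numStates := by
      rcases hp.lt_rank hv with h' | ⟨h', h''⟩
      · rw [h', hz]; exact I.numStates_pos
      · exact (hI _ h' (by omega)).1
    refine Runs.seq (Runs.setNat (Runs.setNat ?_))
    simp only [Store.setNat, NExpr.eval, h9, hb.n, e17, e18, e20, Nat.reduceEqDiff, false_and,
      if_false, if_true, and_self, true_and, and_true]
    refine ⟨by simpa [hv.ne'] using hz, fun u hu hur => ?_⟩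
    by_cases huv : u = v
    · subst huv
      simp only [if_true, if_neg hpv]
      exact ⟨h20 u hu _ hσp, trivial⟩
    · have hne : I.rank u ≠ I.rank v := fun h' =>
        huv (I.rank_injOn (by simpa using hu) (by simpa using hv) h')
      have hpu : par u ≠ v := by
        rcases hp.lt_rank hu with h' | ⟨_, h'⟩
        · omega
        · intro h''; rw [h''] at h'; omega
      simp only [if_neg huv, if_neg hpu]
      exact hI u hu (by omega)
  · rintro s' ⟨hz, hI⟩
    refine ⟨fun v hv => ?_, fun v hv => (hI v hv (by omega)).2⟩
    rcases hv.lt_or_eq with hv | rfl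
    · exact (hI v hv (by omega)).1
    · rw [hz]; exact I.numStates_pos

open Classical in
theorem runs_progOutput {σ : ℕ → ℕ} (h : Tables I s) (hσ : ∀ v < I.n, σ v < I.numStates)
    (h21 : ∀ v, s.nat 21 v 0 = σ v)
    (h19 : ∀ v < I.n, ∀ x < I.numStates, s.nat 19 v x = I.label v x)
    (h4 : ∀ v, s.nat 4 v 0 = 0) (h5 : ∀ u v, s.nat 5 u v = 0) :
    Runs progOutput s (I.n * ((1 + (((1 + ((1 + (1 + 1)) + 1))) + 1)) + 2) + 2)
      (fun s' => (∀ v < I.n, s'.nat 4 v 0 = if I.label v (σ v) < I.levels then 1 else 0) ∧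
        ∀ u < I.n, ∀ v < I.n,
          s'.nat 5 u v = if I.Joins σ u v ∨ I.Joins σ v u then 1 else 0) := by
  refine (Runs.forLoop (m := I.n) (fun j s' =>
      (∀ v, s'.nat 4 v 0 = if v < j ∧ I.label v (σ v) < I.levels then 1 else 0) ∧
        ∀ u v, s'.nat 5 u v =
          if (u < j ∧ I.Joins σ u v) ∨ (v < j ∧ I.Joins σ v u) then 1 else 0)
      (by rfl) ?_ ?_ ?_).mono le_rfl ?_
  · intro s' hs'
    simp [NExpr.eval, hs'.nat 0 rfl, h.n]
  · simp [Store.setNat, h4, h5]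
  · rintro v hv s₁ hs h9 ⟨hI, hI'⟩
    have hb := h.agree hs rfl rfl
    have e21 : s₁.nat 21 v 0 = σ v := by rw [hs.nat 21 rfl, h21]
    have e19 : s₁.nat 19 v (σ v) = I.label v (σ v) := by
      rw [hs.nat 19 rfl, h19 v hv _ (hσ v hv)]
    have hlt : ∀ u, u < v + 1 ↔ u < v ∨ u = v := fun u => Nat.lt_succ_iff_lt_or_eq
    refine Runs.seq (Runs.setNat ?_)
    simp only [NExpr.eval, h9, e21, e19]
    refine Runs.ite (fun hc => Runs.seq (Runs.setNat (Runs.ite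
      (fun hc' => Runs.seq (Runs.setNat (Runs.seq (Runs.setNat (Runs.setNat ?_)))))
      (fun hc' => (Runs.skip ?_).mono (by omega) fun _ h => h))))
      (fun hc => (Runs.skip ?_).mono (by omega) fun _ h => h)
    · have h₁ : I.label v (σ v) < I.levels := by
        simpa [BExpr.Holds, NExpr.eval, Store.setNat, hb.levels] using hc
      have h₂ : 0 < I.label v (σ v) := by
        simpa [BExpr.Holds, NExpr.eval, Store.setNat, hb.levels] using hc'
      have hJ : ∀ p, I.Joins σ v p ↔ p = I.digit (σ v) (I.label v (σ v) - 1) := fun p => by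
        simp [Problem.Joins, h₁, h₂, eq_comm]
      have e16 := hb.digit _ (hσ v hv) (I.label v (σ v) - 1) (by omega)
      simp only [Store.setNat, NExpr.eval, h9, e21, e16, Nat.reduceEqDiff, false_and,
        if_false, if_true, and_self, true_and, and_true]
      refine ⟨fun u => ?_, fun u w => ?_⟩
      · by_cases huv : u = v
        · simp [huv, h₁]
        · simp [huv, hlt, hI]
      · simp only [hI', hlt, or_and_right]
        by_cases huv : u = v <;> by_cases hwv : w = v
        · subst huv hwv
          simp [hJ]
        · subst huv
          simp only [hwv, hJ, if_false, and_false, or_false, true_and, false_and]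
          split_ifs <;> tauto
        · subst hwv
          simp only [huv, hJ, if_false, or_false, true_and, false_and, and_true]
          split_ifs <;> tauto
        · simp [huv, hwv]
    · have h₁ : I.label v (σ v) < I.levels := by
        simpa [BExpr.Holds, NExpr.eval, Store.setNat, hb.levels] using hc
      have h₂ : I.label v (σ v) = 0 := by
        simpa [BExpr.Holds, NExpr.eval, Store.setNat, hb.levels] using hc'
      have hJ : ∀ p, ¬ I.Joins σ v p := fun p => by simp [Problem.Joins, h₂]
      simp only [Store.setNat, NExpr.eval, h9, Nat.reduceEqDiff, false_and,
        if_false, and_self, true_and, and_true]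
      refine ⟨fun u => ?_, fun u w => ?_⟩
      · by_cases huv : u = v
        · simp [huv, h₁]
        · simp [huv, hlt, hI]
      · simp only [hI', hlt, or_and_right]
        by_cases huv : u = v <;> by_cases hwv : w = v <;> simp [huv, hwv, hJ]
    · have h₁ : ¬ I.label v (σ v) < I.levels := by
        simpa [BExpr.Holds, NExpr.eval, Store.setNat, hb.levels] using hc
      have hJ : ∀ p, ¬ I.Joins σ v p := fun p => by simp [Problem.Joins, h₁]
      simp only [Store.setNat, Nat.reduceEqDiff, false_and, if_false]
      refine ⟨fun u => ?_, fun u w => ?_⟩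
      · by_cases huv : u = v
        · simp [huv, h₁, hI]
        · simp [huv, hlt, hI]
      · simp only [hI', hlt, or_and_right]
        by_cases huv : u = v <;> by_cases hwv : w = v <;> simp [huv, hwv, hJ]
  · rintro s' ⟨h₁, h₂⟩
    refine ⟨fun v hv => ?_, fun u hu v hv => ?_⟩
    · rw [h₁]; simp [hv]
    · rw [h₂]; simp [hu, hv]

/-! ### Running time and the composed program -/

theorem Problem.n_le_numStates (I : Problem) : I.n ≤ I.numStates :=
  Nat.le_self_pow (Nat.succ_ne_zero _) _

/-- This is why depths are cut off at `n`: for `n = 1` the time bound is constant, so the number of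
levels must not grow with `k`. -/
theorem Problem.levels_le (I : Problem) : I.levels ≤ 2 * I.numStates := by
  have h₁ : I.levels ≤ I.n + 1 := Nat.succ_le_succ (min_le_right _ _)
  have h₂ := I.n_le_numStates
  have := I.n_pos
  omega

/-- The exponent 8 comes from `levels ≤ k + 1 ≤ 2 * k`. -/
theorem Problem.numStates_pow_le (I : Problem) : I.numStates ^ 4 ≤ I.n ^ (8 * I.k) := by
  have h₁ : I.levels ≤ I.k + 1 := Nat.succ_le_succ (min_le_left _ _)
  have := I.one_le_k
  rw [Problem.numStates, ← pow_mul]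
  exact Nat.pow_le_pow_right I.n_pos (by omega)

/-- Bounds for the monomials that occur in the running time. -/
theorem monomial_bounds {n L S : ℕ} (hS : 1 ≤ S) (hn : n ≤ S) (hL : L ≤ 2 * S) :
    1 ≤ S ^ 4 ∧ S ≤ S ^ 4 ∧ n ≤ S ^ 4 ∧ L ≤ 2 * S ^ 4 ∧ n * n ≤ S ^ 4 ∧ n * S ≤ S ^ 4 ∧
      L * n ≤ 2 * S ^ 4 ∧ S * L ≤ 2 * S ^ 4 ∧ n * S * S ≤ S ^ 4 ∧ n * S * L ≤ 2 * S ^ 4 ∧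
      n * S * S * L ≤ 2 * S ^ 4 := by
  have p : ∀ j ≤ 4, S ^ j ≤ S ^ 4 := fun j hj => Nat.pow_le_pow_right hS hj
  have h1 : S ≤ S ^ 4 := by simpa using p 1 (by omega)
  have h2 : S * S ≤ S ^ 4 := by simpa [sq] using p 2 (by omega)
  have h3 : S * S * S ≤ S ^ 4 := by simpa [pow_succ] using p 3 (by omega)
  refine ⟨by simpa using p 0 (by omega), h1, hn.trans h1, by omega, ?_, ?_, ?_, ?_, ?_, ?_, ?_⟩
  · exact (Nat.mul_le_mul hn hn).trans h2
  · exact (Nat.mul_le_mul_right _ hn).trans h2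
  · exact (Nat.mul_le_mul hL hn).trans (by linarith)
  · exact (Nat.mul_le_mul_left _ hL).trans (by linarith)
  · exact (Nat.mul_le_mul_right _ (Nat.mul_le_mul_right _ hn)).trans h3
  · exact (Nat.mul_le_mul (Nat.mul_le_mul_right _ hn) hL).trans (by linarith)
  · exact (Nat.mul_le_mul (Nat.mul_le_mul_right _ (Nat.mul_le_mul_right _ hn)) hL).trans
      (by linarith)

open Classical in
/-- The program terminates in time and outputs an assignment of minimum total cost. -/
theorem runs_steinerProg (I : Problem) :
    Runs steinerProg I.input (1000 * I.n ^ (1000 * I.k)) (fun s' => ∃ par σ : ℕ → ℕ,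
      I.IsParentMap par ∧
      (∀ τ : ℕ → ℕ, (∀ v < I.n, τ v < I.numStates) → I.totalCost par σ ≤ I.totalCost par τ) ∧
      (∀ v < I.n, s'.nat 4 v 0 = if I.label v (σ v) < I.levels then 1 else 0) ∧
        ∀ u < I.n, ∀ v < I.n,
          s'.nat 5 u v = if I.Joins σ u v ∨ I.Joins σ v u then 1 else 0) := by
  -- Each of the ten phases gets the budget `B`, whence the constant `1000 = 10 * 100`.
  obtain ⟨B, hB⟩ : ∃ B, B = 100 * I.numStates ^ 4 := ⟨_, rfl⟩
  obtain ⟨m₁, m₂, m₃, m₄, m₅, m₆, m₇, m₈, m₉, m₁₀, m₁₁⟩ :=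
    monomial_bounds I.numStates_pos I.n_le_numStates I.levels_le
  have m₁₂ : I.numStates * (I.levels - 1) ≤ I.numStates * I.levels :=
    Nat.mul_le_mul_left _ (Nat.sub_le _ _)
  have htime : 10 * B ≤ 1000 * I.n ^ (1000 * I.k) := by
    rw [hB, ← mul_assoc]
    exact Nat.mul_le_mul_left _ (I.numStates_pow_le.trans (Nat.pow_le_pow_right I.n_pos (by omega)))
  refine Runs.mono (T := B + (B + (B + (B + (B + (B + (B + (B + (B + B))))))))) ?_ (by omega)
    fun _ h => h
  have b₀ := Base.input I
  refine Runs.seq' ((runs_progLevels b₀).mono (by linarith) fun _ h => h) fun s₁ a₁ h6 => ?_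
  have b₁ := b₀.agree a₁ rfl
  refine Runs.seq' ((runs_progStates b₁ h6).mono (by linarith) fun _ h => h) fun s₂ a₂ h7 => ?_
  have b₂ := b₁.agree a₂ rfl
  rw [← a₂.nat 6 rfl] at h6
  refine Runs.seq' ((runs_progDigits b₂ h6 h7).mono (by linarith) fun _ h => h) fun s₃ a₃ h16 => ?_
  have b₃ := b₂.agree a₃ rfl
  rw [← a₃.nat 6 rfl] at h6
  rw [← a₃.nat 7 rfl] at h7
  refine Runs.seq' ((runs_progBig b₃).mono (by linarith) fun _ h => h) fun s₄ a₄ h1 => ?_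
  have t₄ : Tables I s₄ := ⟨b₃.agree a₄ rfl, by rw [a₄.nat 6 rfl, h6], by rw [a₄.nat 7 rfl, h7],
    h1, by rw [a₄.nat 16 rfl]; exact h16⟩
  refine Runs.seq' ((runs_progOrder t₄.toBase).mono (by linarith) fun _ h => h) fun s₅ a₅ h17 => ?_
  have t₅ := t₄.agree a₅ rfl rfl
  refine Runs.seq' ((runs_progParents t₅.toBase).mono (by linarith) fun _ h => h) fun s₆ a₆ hpar => ?_
  have t₆ := t₅.agree a₆ rfl rfl
  have z2 : ∀ x, s₆.rat 2 I.n x = 0 := fun x => by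
    rw [a₆.rat 2 rfl, a₅.rat 2 rfl, a₄.rat 2 rfl, a₃.rat 2 rfl, a₂.rat 2 rfl, a₁.rat 2 rfl]
    simp [Problem.input]
  refine Runs.seq'
    ((runs_progCosts t₆.toBase t₆.levels t₆.states t₆.big t₆.digit z2).mono (by linarith) fun _ h => h) fun s₇ a₇ h2 => ?_
  have t₇ := t₆.agree a₇ rfl rfl
  have h17₇ : ∀ v < I.n, s₇.nat 17 (I.rank v) 0 = v := by
    rw [a₇.nat 17 rfl, a₆.nat 17 rfl]; exact h17
  have h18₇ : ∀ v, s₇.nat 18 v 0 = s₆.nat 18 v 0 := fun v => by rw [a₇.nat 18 rfl]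
  refine Runs.seq' ((runs_progEliminateAll t₇ hpar h18₇ h17₇
    (fun v hv x hx => (h2.1 v hv x hx).2) h2.2).mono (by linarith) fun _ h => h) fun s₈ a₈ h20 => ?_
  have t₈ := t₇.agree a₈ rfl rfl
  have z21 : s₈.nat 21 I.n 0 = 0 := by
    rw [a₈.nat 21 rfl, a₇.nat 21 rfl, a₆.nat 21 rfl, a₅.nat 21 rfl, a₄.nat 21 rfl,
      a₃.nat 21 rfl, a₂.nat 21 rfl, a₁.nat 21 rfl]
    simp [Problem.input]
  refine Runs.seq' ((runs_progChoose t₈.toBase hpar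
    (fun v => by rw [a₈.nat 18 rfl, h18₇]) (by rw [a₈.nat 17 rfl]; exact h17₇) h20.1 z21).mono (by linarith) fun _ h => h)
    fun s₉ a₉ h21 => ?_
  have t₉ := t₈.agree a₉ rfl rfl
  have z4 : ∀ v, s₉.nat 4 v 0 = 0 := fun v => by
    rw [a₉.nat 4 rfl, a₈.nat 4 rfl, a₇.nat 4 rfl, a₆.nat 4 rfl, a₅.nat 4 rfl, a₄.nat 4 rfl,
      a₃.nat 4 rfl, a₂.nat 4 rfl, a₁.nat 4 rfl]
    simp [Problem.input]
  have z5 : ∀ u v, s₉.nat 5 u v = 0 := fun u v => by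
    rw [a₉.nat 5 rfl, a₈.nat 5 rfl, a₇.nat 5 rfl, a₆.nat 5 rfl, a₅.nat 5 rfl, a₄.nat 5 rfl,
      a₃.nat 5 rfl, a₂.nat 5 rfl, a₁.nat 5 rfl]
    simp [Problem.input]
  refine (runs_progOutput (σ := fun v => s₉.nat 21 v 0) t₉ (fun v hv => h21.1 v hv.le)
    (fun _ => rfl) (fun v hv x hx => ?_) z4 z5).mono (by linarith) fun s₁₀ h => ?_
  · rw [a₉.nat 19 rfl, a₈.nat 19 rfl]
    exact (h2.1 v hv x hx).1
  refine ⟨_, _, hpar, fun τ hτ => ?_, h.1, h.2⟩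
  obtain ⟨-, h20⟩ := h20
  rw [← (h20 _ h21.1).2 h21.2]
  set σ := fun v => s₉.nat 21 v 0
  -- The two assignments are made to agree at the sentinel. Only the root has it as parent, and the
  -- root incurs no edge penalty, so the cost of `τ` is unaffected.
  have hτ' : ∀ v ≤ I.n, Function.update τ I.n (σ I.n) v < I.numStates := by
    intro v hv
    by_cases hvn : v = I.n
    · subst hvn
      simpa using h21.1 _ le_rfl
    · simpa [hvn] using hτ v (by omega)
  have key := (h20 _ hτ').1
  rw [Function.update_self] at key
  refine key.trans_eq (Finset.sum_congr rfl fun v hv => ?_)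
  have hv := Finset.mem_range.1 hv
  rw [Function.update_of_ne hv.ne]
  by_cases hvr : v = I.root
  · simp [Problem.edgePenalty, hvr]
  · rw [Function.update_of_ne (hpar.isParent v hv hvr).lt.ne]

/-! ### Tree metrics -/

namespace IsTreeMetric

variable {V : Type*} {G : SimpleGraph V} {w : Sym2 V → ℚ} {d : V → V → ℚ}

theorem dist_eq_weight (hG : G.IsTree) (h : Induces G w d) {u v : V} {p : G.Walk u v}
    (hp : p.IsPath) : d u v = (p.edges.map w).sum := by
  obtain ⟨q, hq, hd⟩ := (h.2 u v).1
  rw [hd, (hG.existsUnique_path u v).unique hp hq]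

theorem dist_eq_of_mem_support (hG : G.IsTree) (h : Induces G w d) {u v x : V} {p : G.Walk u v}
    (hp : p.IsPath) (hx : x ∈ p.support) : d u v = d u x + d x v := by
  classical
  rw [dist_eq_weight hG h hp, dist_eq_weight hG h (hp.takeUntil hx),
    dist_eq_weight hG h (hp.dropUntil hx), ← List.sum_append, ← List.map_append,
    ← SimpleGraph.Walk.edges_append, SimpleGraph.Walk.take_spec]

/-- Either `u` is on the path from `v` to `x`, or prepending the edge gives the path from `u` to
`x`. -/
theorem dist_adj (hG : G.IsTree) (h : Induces G w d) {u v : V} (huv : G.Adj u v) (x : V) :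
    d u x = d u v + d v x ∨ d v x = d v u + d u x := by
  obtain ⟨p, hp, -⟩ := hG.existsUnique_path v x
  by_cases hu : u ∈ p.support
  · exact Or.inr (dist_eq_of_mem_support hG h hp hu)
  · exact Or.inl (dist_eq_of_mem_support hG h (p := .cons huv p) (hp.cons hu) (by simp))

theorem exists_adj_between (hG : G.IsTree) (h : Induces G w d) {v x : V} (hvx : v ≠ x) :
    ∃ u, G.Adj v u ∧ d v x = d v u + d u x := by
  obtain ⟨p, hp, -⟩ := hG.existsUnique_path v x
  cases p with
  | nil => exact absurd rfl hvx
  | @cons _ u _ hvu q => exact ⟨u, hvu, dist_eq_of_mem_support hG h hp (by simp)⟩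

/-- By positivity, `v` is not on the path from `u` to `x`, so that path extends to the path from
`v`; the latter is unique and determines its second vertex. -/
theorem eq_of_adj_between (hG : G.IsTree) (h : Induces G w d) (hcomm : ∀ u v, d u v = d v u)
    (hpos : ∀ u v, u ≠ v → 0 < d u v) {v x u u' : V} (hu : G.Adj v u) (hu' : G.Adj v u')
    (hd : d v x = d v u + d u x) (hd' : d v x = d v u' + d u' x) : u = u' := by
  have key : ∀ {u}, (hu : G.Adj v u) → d v x = d v u + d u x →
      ∃ p : G.Walk u x, (SimpleGraph.Walk.cons hu p).IsPath := by
    intro u hu hd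
    obtain ⟨p, hp, -⟩ := hG.existsUnique_path u x
    refine ⟨p, hp.cons fun hv => ?_⟩
    have := dist_eq_of_mem_support hG h hp hv
    have := hpos v u hu.ne
    rw [hcomm u v] at *
    linarith
  obtain ⟨p, hp⟩ := key hu hd
  obtain ⟨p', hp'⟩ := key hu' hd'
  have := congrArg SimpleGraph.Walk.snd ((hG.existsUnique_path v x).unique hp hp')
  simpa using this

end IsTreeMetric

/-! ### Recovering the tree from the distances, and consistency along its paths -/

namespace Problem

variable {G : SimpleGraph (Fin I.n)} {w : Sym2 (Fin I.n) → ℚ} {par σ : ℕ → ℕ}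

/-- The first vertex on the path from `v` to `p` also lies between `v` and the root, so it is `u`.
Hence `u` lies between `v` and `p`, and `p` being closest forces `p = u`. -/
theorem IsParent.eq_of_adj (hG : G.IsTree) (h : Induces G w I.dist) {v p u : Fin I.n}
    (hp : I.IsParent v p) (huv : G.Adj v u) (hd : I.dist I.root v = I.dist I.root u + I.dist u v) :
    p = u := by
  have hcomm := I.dist_comm
  have hpv : v ≠ p := fun h => hp.ne (by rw [h])
  have hb := hp.between
  have hc := hp.closest u u.2 (fun h => huv.ne (Fin.ext h.symm))
  simp only [matrix_fin] at hb hc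
  obtain ⟨u', hu', hd'⟩ := IsTreeMetric.exists_adj_between hG h hpv
  have huu' : u' = u := by
    refine IsTreeMetric.eq_of_adj_between hG h hcomm (fun _ _ => I.dist_pos) (x := I.root)
      hu' huv ?_ ?_
    · have h₁ := I.dist_triangle v u' I.root
      have h₂ := I.dist_triangle u' p I.root
      have := hcomm v I.root
      have := hcomm p I.root
      have := hcomm p v
      linarith
    · have := hcomm v I.root
      have := hcomm u I.root
      have := hcomm u v
      linarith
  subst huu'
  by_contra hne
  have := I.dist_pos (Ne.symm hne)
  have := hc hd
  have := hcomm p v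
  have := hcomm u' v
  linarith

/-- Adjacent points of the tree are each other's parents. -/
theorem IsParentMap.eq_or_eq (hpar : I.IsParentMap par) (hG : G.IsTree)
    (h : Induces G w I.dist) {v u : Fin I.n} (huv : G.Adj v u) :
    (v ≠ I.root ∧ par v = u) ∨ (u ≠ I.root ∧ par u = v) := by
  have hcomm := I.dist_comm
  have key : ∀ {v u : Fin I.n}, G.Adj v u → I.dist v I.root = I.dist v u + I.dist u I.root →
      v ≠ I.root ∧ par v = u := by
    intro v u huv hd
    have hvr : v ≠ I.root := by
      rintro rfl
      have := I.dist_pos huv.ne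
      have := I.dist_nonneg u I.root
      rw [(I.dist_eq_zero _ _).2 rfl] at hd
      linarith
    have hp := hpar.isParent v v.2 (fun h => hvr (Fin.ext h))
    refine ⟨hvr, congrArg Fin.val (IsParent.eq_of_adj hG h (p := ⟨par v, hp.lt⟩) hp huv ?_)⟩
    have := hcomm v I.root
    have := hcomm u I.root
    have := hcomm u v
    linarith
  rcases IsTreeMetric.dist_adj hG h huv I.root with hd | hd
  · exact Or.inl (key huv hd)
  · exact Or.inr (key huv.symm hd)

/-- If there are no conflicts, then points assigned to some point are assigned to themselves. -/
theorem digit_digit_eq (hpar : I.IsParentMap par) (ht : IsTreeMetric I.dist) {i : ℕ}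
    (hσ : ∀ v < I.n, v ≠ I.root → ¬ I.Conflict v (par v) (σ v) (σ (par v)) i) {v : ℕ}
    (hv : v < I.n) : I.digit (σ (I.digit (σ v) i)) i = I.digit (σ v) i := by
  classical
  obtain ⟨G, w, hG, h⟩ := ht
  obtain ⟨x, hx⟩ : ∃ x : Fin I.n, (x : ℕ) = I.digit (σ v) i := ⟨⟨_, I.digit_lt _ _⟩, rfl⟩
  rw [← hx]
  -- Among the points that name `x`, take one nearest to `x`. If it is not `x`, its neighbour
  -- towards `x` must name `x` as well, for lack of conflict, and is nearer. The neighbour may be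
  -- the parent or a child, hence the symmetric form of `Conflict`.
  obtain ⟨u, hu, hmin⟩ := Finset.exists_min_image
    (Finset.univ.filter fun u : Fin I.n => I.digit (σ u) i = x) (I.dist · x)
    ⟨⟨v, hv⟩, by simp [hx]⟩
  simp only [Finset.mem_filter, Finset.mem_univ, true_and] at hu hmin
  by_cases hux : u = x
  · rwa [hux] at hu
  · exfalso
    obtain ⟨u', huu', hd⟩ := IsTreeMetric.exists_adj_between hG h hux
    have hpos := I.dist_pos huu'.ne
    suffices hu' : I.digit (σ u') i = x by
      have := hmin u' hu'
      linarith
    by_contra hne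
    rcases hpar.eq_or_eq hG h huu' with ⟨hr, hp⟩ | ⟨hr, hp⟩
    · refine hσ u u.2 (fun h => hr (Fin.ext h)) ⟨?_, fun hlt => ?_⟩
      · rw [hp, hu]; exact Ne.symm hne
      · have := hlt.1
        rw [hp, hu, matrix_fin, matrix_fin, matrix_fin] at this
        linarith
    · refine hσ u' u'.2 (fun h => hr (Fin.ext h)) ⟨?_, fun hlt => ?_⟩
      · rw [hp, hu]; exact hne
      · have := hlt.2
        rw [hp, hu, matrix_fin, matrix_fin, matrix_fin] at this
        linarith

/-! ### Labels -/

theorem labelBelow_spec (I : Problem) (v s m : ℕ) : I.labelBelow v s m ≤ m ∧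
    (∀ i < I.labelBelow v s m, I.digit s i ≠ v) ∧
    (I.labelBelow v s m < m → I.digit s (I.labelBelow v s m) = v) := by
  induction m with
  | zero => simp [labelBelow]
  | succ m ih =>
    obtain ⟨h₁, h₂, h₃⟩ := ih
    rw [labelBelow]
    split_ifs with h
    · refine ⟨le_rfl, fun i hi => ?_, fun h' => absurd h' (lt_irrefl _)⟩
      rcases Nat.lt_succ_iff_lt_or_eq.1 hi with hi | rfl
      · exact h₂ i (by omega)
      · exact h.2
    · refine ⟨by omega, h₂, fun _ => ?_⟩
      by_cases hm : I.labelBelow v s m = m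
      · rw [hm]
        by_contra h'
        exact h ⟨hm, h'⟩
      · exact h₃ (by omega)

theorem digit_label {v s : ℕ} (h : I.label v s < I.levels) : I.digit s (I.label v s) = v :=
  (I.labelBelow_spec v s I.levels).2.2 h

theorem label_le {v s i : ℕ} (h : I.digit s i = v) : I.label v s ≤ i := by
  by_contra hi
  exact (I.labelBelow_spec v s I.levels).2.1 i (not_le.1 hi) h

theorem label_eq {v s i : ℕ} (hi : i < I.levels) (h : I.digit s i = v)
    (h' : ∀ j < i, I.digit s j ≠ v) : I.label v s = i := by
  have h₁ := label_le h
  by_contra hne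
  exact h' _ (by omega) (digit_label (h₁.trans_lt hi))

theorem le_label {v s : ℕ} (h : ∀ i < I.levels, I.digit s i ≠ v) : I.levels ≤ I.label v s := by
  by_contra hl
  exact h _ (not_le.1 hl) (digit_label (not_le.1 hl))

/-! ### Costs -/

theorem vertexCost_nonneg (I : Problem) (v s : ℕ) : 0 ≤ I.vertexCost v s := by
  unfold vertexCost
  split_ifs <;> first | exact I.big_pos.le | exact le_rfl | exact I.matrix_nonneg _ _

theorem edgePenalty_nonneg (I : Problem) (v p s s' : ℕ) : 0 ≤ I.edgePenalty v p s s' := by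
  unfold edgePenalty
  split_ifs <;> first | exact I.big_pos.le | exact le_rfl

/-- The assignment of states to points violates no condition. -/
structure Valid (I : Problem) (par σ : ℕ → ℕ) : Prop where
  digit_zero : ∀ v < I.n, I.digit (σ v) 0 = I.root
  terminal : ∀ v < I.n, I.IsTerminal v → I.label v (σ v) < I.levels
  conflict : ∀ v < I.n, v ≠ I.root → ∀ i < I.levels, ¬ I.Conflict v (par v) (σ v) (σ (par v)) i

/-- All summands are nonnegative, so a single violated condition already costs `big`. -/
theorem valid_of_totalCost_lt (h : I.totalCost par σ < I.big) : I.Valid par σ := by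
  have key : ∀ v < I.n, I.vertexCost v (σ v) < I.big ∧
      I.edgePenalty v (par v) (σ v) (σ (par v)) < I.big := by
    intro v hv
    have h₁ := Finset.single_le_sum (s := Finset.range I.n)
      (f := fun v => I.vertexCost v (σ v) + I.edgePenalty v (par v) (σ v) (σ (par v)))
      (fun v _ => add_nonneg (I.vertexCost_nonneg _ _) (I.edgePenalty_nonneg _ _ _ _))
      (Finset.mem_range.2 hv)
    have h₂ := h₁.trans_lt h
    have := I.vertexCost_nonneg v (σ v)
    have := I.edgePenalty_nonneg v (par v) (σ v) (σ (par v))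
    constructor <;> linarith
  refine ⟨fun v hv => ?_, fun v hv ht => ?_, fun v hv hr i hi hc => ?_⟩
  · by_contra h'
    have := (key v hv).1
    rw [vertexCost, if_pos h'] at this
    exact lt_irrefl _ this
  · by_contra h'
    have := (key v hv).1
    rw [vertexCost] at this
    split_ifs at this
    · exact lt_irrefl _ this
    · exact lt_irrefl _ this
  · have := (key v hv).2
    rw [edgePenalty, if_pos ⟨hr, i, hi, hc⟩] at this
    exact lt_irrefl _ this

theorem Valid.totalCost_eq (h : I.Valid par σ) : I.totalCost par σ =
    ∑ v ∈ Finset.range I.n, if 0 < I.label v (σ v) ∧ I.label v (σ v) < I.levels then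
      I.matrix v (I.digit (σ v) (I.label v (σ v) - 1)) else 0 := by
  refine Finset.sum_congr rfl fun v hv => ?_
  have hv := Finset.mem_range.1 hv
  have hp : I.edgePenalty v (par v) (σ v) (σ (par v)) = 0 := by
    rw [edgePenalty, if_neg]
    rintro ⟨hr, i, hi, hc⟩
    exact h.conflict v hv hr i hi hc
  rw [hp, add_zero, vertexCost, if_neg (not_not.2 (h.digit_zero v hv))]
  by_cases hl : I.label v (σ v) < I.levels
  · simp [hl]
  · rw [if_neg hl, if_neg (fun ht => hl (h.terminal v hv ht)), if_neg (fun h' => hl h'.2)]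

/-! ### From assignments to trees -/

/-- The parent of `v` is named at depth `label - 1`, so it names itself there. -/
theorem Valid.label_lt_of_joins (hσ : I.Valid par σ) (hpar : I.IsParentMap par)
    (ht : IsTreeMetric I.dist) {v p : ℕ} (hv : v < I.n) (h : I.Joins σ v p) :
    I.label p (σ p) < I.label v (σ v) := by
  obtain ⟨h₁, h₂, rfl⟩ := h
  have hc := digit_digit_eq hpar ht (i := I.label v (σ v) - 1)
    (fun u hu hr => hσ.conflict u hu hr _ (by omega)) hv
  have := label_le hc
  omega

theorem not_joins_self (v : ℕ) : ¬ I.Joins σ v v := by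
  rintro ⟨h₁, h₂, h₃⟩
  have := label_le h₃
  omega

theorem Valid.eq_root_of_label_eq_zero (hσ : I.Valid par σ) {v : ℕ} (hv : v < I.n)
    (h : I.label v (σ v) = 0) : v = I.root := by
  have h₁ := digit_label (s := σ v) (v := v) (by rw [h]; exact Nat.succ_pos _)
  rw [h, hσ.digit_zero v hv] at h₁
  exact h₁.symm

theorem Valid.label_root (hσ : I.Valid par σ) : I.label I.root (σ I.root) = 0 :=
  Nat.le_zero.1 (label_le (hσ.digit_zero _ I.root.2))

/-- The graph formed by the used points and the edges to their parents. -/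
theorem Valid.exists_isSteinerTree (hσ : I.Valid par σ) (hpar : I.IsParentMap par)
    (ht : IsTreeMetric I.dist) :
    ∃ T : (⊤ : SimpleGraph (Fin I.n)).Subgraph, I.IsSteinerTree T ∧
      I.cost T ≤ I.totalCost par σ ∧
      (∀ v : Fin I.n, v ∈ T.verts ↔ I.label v (σ v) < I.levels) ∧
      ∀ u v : Fin I.n, T.Adj u v ↔ I.Joins σ u v ∨ I.Joins σ v u := by
  classical
  have hlt : ∀ {v p : Fin I.n}, I.Joins σ v p → I.label p (σ p) < I.label v (σ v) :=
    fun {v p} h => hσ.label_lt_of_joins hpar ht v.2 h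
  obtain ⟨T, hverts, hadj⟩ : ∃ T : (⊤ : SimpleGraph (Fin I.n)).Subgraph,
      (∀ v : Fin I.n, v ∈ T.verts ↔ I.label v (σ v) < I.levels) ∧
      ∀ u v : Fin I.n, T.Adj u v ↔ I.Joins σ u v ∨ I.Joins σ v u :=
    ⟨{ verts := {v | I.label v (σ v) < I.levels}
       Adj := fun u v => I.Joins σ u v ∨ I.Joins σ v u
       adj_sub := by
        rintro u v h
        rw [SimpleGraph.top_adj]
        rintro rfl
        exact not_joins_self _ (h.elim id id)
       edge_vert := by
        rintro u v (h | h)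
        · exact h.2.1
        · exact (hlt h).trans h.2.1
       symm := ⟨fun u v h => Or.symm h⟩ }, fun _ => Iff.rfl, fun _ _ => Iff.rfl⟩
  have hroot : I.root ∈ T.verts := by
    rw [hverts, hσ.label_root]
    exact Nat.succ_pos _
  obtain ⟨parent, hparent⟩ : ∃ parent : Fin I.n → Fin I.n,
      ∀ v, (parent v : ℕ) = I.digit (σ v) (I.label v (σ v) - 1) :=
    ⟨fun v => ⟨_, I.digit_lt _ _⟩, fun _ => rfl⟩
  have hjoins : ∀ v p : Fin I.n, I.Joins σ v p ↔
      (0 < I.label v (σ v) ∧ I.label v (σ v) < I.levels) ∧ parent v = p := by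
    intro v p
    rw [Joins, and_assoc, Fin.ext_iff, hparent]
  obtain ⟨A, hA', hA⟩ : ∃ A : Finset (Fin I.n), A = Finset.univ.filter (fun v : Fin I.n =>
      0 < I.label v (σ v) ∧ I.label v (σ v) < I.levels) ∧
      ∀ v : Fin I.n, v ∈ A ↔ 0 < I.label v (σ v) ∧ I.label v (σ v) < I.levels :=
    ⟨_, rfl, by simp⟩
  have hAj : ∀ {v}, v ∈ A → T.Adj v (parent v) := fun {v} hv =>
    (hadj _ _).2 (Or.inl ((hjoins _ _).2 ⟨(hA v).1 hv, rfl⟩))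
  -- Labels drop along parent edges and only the root has label 0, so following parents reaches the
  -- root within `label` steps.
  have hwalk : ∀ m, ∀ v (hv : v ∈ T.verts), I.label v (σ v) = m →
      ∃ q : T.coe.Walk ⟨I.root, hroot⟩ ⟨v, hv⟩, q.length ≤ m := by
    intro m
    induction m using Nat.strong_induction_on with
    | _ m ih =>
      intro v hv hm
      by_cases h0 : m = 0
      · obtain rfl : v = I.root := Fin.ext (hσ.eq_root_of_label_eq_zero v.2 (hm.trans h0))
        exact ⟨.nil, by simp⟩
      · have hvA : v ∈ A := (hA v).2 ⟨by omega, (hverts v).1 hv⟩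
        have hj := hAj hvA
        have hl := hlt ((hjoins v (parent v)).2 ⟨(hA v).1 hvA, rfl⟩)
        obtain ⟨q, hq⟩ := ih _ (hm ▸ hl) (parent v) (T.edge_vert hj.symm) rfl
        refine ⟨q.concat (show T.coe.Adj ⟨parent v, _⟩ ⟨v, hv⟩ from hj.symm), ?_⟩
        rw [SimpleGraph.Walk.length_concat]
        omega
  have hconn : T.coe.Connected := by
    have : Nonempty T.verts := ⟨⟨I.root, hroot⟩⟩
    refine SimpleGraph.Connected.mk fun u v => ?_
    obtain ⟨p, -⟩ := hwalk _ u u.2 rfl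
    obtain ⟨q, -⟩ := hwalk _ v v.2 rfl
    exact ⟨p.reverse.append q⟩
  have hcardV : Nat.card T.verts = A.card + 1 := by
    have hrA : I.root ∉ A := by
      rw [hA, hσ.label_root]
      simp
    have : T.verts = ((insert I.root A : Finset (Fin I.n)) : Set (Fin I.n)) := by
      ext v
      simp only [Finset.coe_insert, Set.mem_insert_iff, Finset.mem_coe, hA]
      constructor
      · intro hv
        by_cases h0 : I.label v (σ v) = 0
        · exact Or.inl (Fin.ext (hσ.eq_root_of_label_eq_zero v.2 h0))
        · exact Or.inr ⟨by omega, (hverts v).1 hv⟩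
      · rintro (rfl | h)
        · exact hroot
        · exact (hverts v).2 h.2
    rw [Nat.card_coe_set_eq, this, Set.ncard_coe_finset, Finset.card_insert_of_notMem hrA]
  -- Every edge comes from a used point other than the root. With connectivity, this count forces a
  -- tree.
  have hcardE : Nat.card T.coe.edgeSet ≤ A.card := by
    let f : A → T.coe.edgeSet := fun v =>
      ⟨s(⟨v, T.edge_vert (hAj v.2)⟩, ⟨parent v, T.edge_vert (hAj v.2).symm⟩), hAj v.2⟩
    have hf : Function.Surjective f := by
      rintro ⟨e, he⟩
      induction e using Sym2.ind with
      | _ u v =>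
        rcases (hadj u v).1 he with h | h
        · obtain ⟨h₁, h₂⟩ := (hjoins _ _).1 h
          exact ⟨⟨u, (hA _).2 h₁⟩, Subtype.ext (Sym2.eq_iff.2 (Or.inl ⟨rfl, Subtype.ext h₂⟩))⟩
        · obtain ⟨h₁, h₂⟩ := (hjoins _ _).1 h
          exact ⟨⟨v, (hA _).2 h₁⟩, Subtype.ext (Sym2.eq_iff.2 (Or.inr ⟨rfl, Subtype.ext h₂⟩))⟩
    simpa using Nat.card_le_card_of_surjective f hf
  have htree : T.coe.IsTree := by
    rw [SimpleGraph.isTree_iff_connected_and_card]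
    have := hconn.card_vert_le_card_edgeSet_add_one
    exact ⟨hconn, by omega⟩
  refine ⟨T, ⟨htree, fun v hv => (hverts v).2 (hσ.terminal v v.2 ⟨v, hv, rfl⟩), fun hr v p hp => ?_⟩, ?_, hverts,
    hadj⟩
  · obtain ⟨q, hq⟩ := hwalk _ v v.2 rfl
    rw [(htree.existsUnique_path _ _).unique hp q.bypass_isPath]
    have h₁ := q.length_bypass_le_length
    have h₂ : I.label v (σ v) < min I.k I.n + 1 := (hverts v).1 v.2
    have := min_le_left I.k I.n
    omega
  · have hE : (Set.toFinite T.edgeSet).toFinset = A.image fun v => s(v, parent v) := by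
      ext e
      induction e using Sym2.ind with
      | _ u v =>
        simp only [Set.Finite.mem_toFinset, SimpleGraph.Subgraph.mem_edgeSet, Finset.mem_image]
        constructor
        · intro he
          rcases (hadj u v).1 he with h | h
          · obtain ⟨h₁, h₂⟩ := (hjoins _ _).1 h
            exact ⟨u, (hA _).2 h₁, by rw [h₂]⟩
          · obtain ⟨h₁, h₂⟩ := (hjoins _ _).1 h
            exact ⟨v, (hA _).2 h₁, by rw [h₂, Sym2.eq_swap]⟩
        · rintro ⟨x, hx, he⟩
          rw [← SimpleGraph.Subgraph.mem_edgeSet, ← he]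
          exact hAj hx
    rw [cost, hE, hσ.totalCost_eq]
    refine (Finset.sum_image_le_of_nonneg fun e _ => ?_).trans_eq ?_
    · induction e using Sym2.ind with
      | _ u v => exact I.dist_nonneg u v
    · rw [← Fin.sum_univ_eq_sum_range (fun v => if 0 < I.label v (σ v) ∧
        I.label v (σ v) < I.levels then I.matrix v (I.digit (σ v) (I.label v (σ v) - 1)) else 0),
        ← Finset.sum_filter, ← hA']
      refine Finset.sum_congr rfl fun v _ => ?_
      rw [← hparent, matrix_fin]
      rfl

/-! ### From trees to assignments -/

/-- States are base-`n` expansions, which `finFunctionFinEquiv` encodes with the same digits. -/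
theorem exists_state (f : ℕ → Fin I.n) :
    ∃ s < I.numStates, ∀ i < I.levels, I.digit s i = f i := by
  let g : Fin I.levels → Fin I.n := fun i => f i
  refine ⟨finFunctionFinEquiv g, (finFunctionFinEquiv g).2, fun i hi => ?_⟩
  have := congrFun (finFunctionFinEquiv.symm_apply_apply g) ⟨i, hi⟩
  exact congrArg Fin.val this

/-- `x` is the point of `L` nearest to `v`, ties being broken by the numbering of the points. -/
structure IsNearest (I : Problem) (L : Finset (Fin I.n)) (v x : Fin I.n) : Prop where
  mem : x ∈ L
  dist_le : ∀ y ∈ L, I.dist v x ≤ I.dist v y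
  le : ∀ y ∈ L, I.dist v x = I.dist v y → x ≤ y

theorem exists_isNearest {L : Finset (Fin I.n)} (hL : L.Nonempty) (v : Fin I.n) :
    ∃ x, I.IsNearest L v x := by
  obtain ⟨x, hx, hmin⟩ := Finset.exists_min_image L (fun x => toLex (I.dist v x, x)) hL
  refine ⟨x, hx, fun y hy => ?_, fun y hy h => ?_⟩ <;>
    rcases Prod.Lex.toLex_le_toLex.1 (hmin y hy) with h' | h'
  · exact h'.le
  · exact h'.1.le
  · exact absurd h h'.ne
  · exact h'.2

variable {L : Finset (Fin I.n)}

theorem IsNearest.eq_self {v x : Fin I.n} (h : I.IsNearest L v x) (hv : v ∈ L) : x = v := by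
  by_contra hne
  have := h.dist_le v hv
  rw [(I.dist_eq_zero v v).2 rfl] at this
  exact (I.dist_pos (Ne.symm hne)).not_ge this

/-- Going via `v`, the point `y` is no farther from `u` than `x` is, so `x` and `y` tie both at `u`
and at `v`; the common numbering then makes the same choice. -/
theorem IsNearest.eq_of_between {u v x y : Fin I.n} (hx : I.IsNearest L u x)
    (hy : I.IsNearest L v y) (h : I.dist u v + I.dist v x ≤ I.dist u x) : x = y := by
  have h₁ := hx.dist_le y hy.mem
  have h₂ := hy.dist_le x hx.mem
  have h₃ := I.dist_triangle u v y
  exact le_antisymm (hx.le y hy.mem (by linarith)) (hy.le x hx.mem (by linarith))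

theorem IsNearest.not_conflict {u v x y : Fin I.n} (hx : I.IsNearest L u x)
    (hy : I.IsNearest L v y) {s s' i : ℕ} (hs : I.digit s i = x) (hs' : I.digit s' i = y) :
    ¬ I.Conflict u v s s' i := by
  rintro ⟨h₁, h₂⟩
  rw [hs, hs'] at h₁ h₂
  simp only [matrix_fin] at h₂
  refine h₂ ⟨?_, ?_⟩
  · by_contra h
    exact h₁ (congrArg Fin.val (hx.eq_of_between hy (not_lt.1 h)))
  · by_contra h
    exact h₁ (congrArg Fin.val (hy.eq_of_between hx (not_lt.1 h)).symm)

/-- The vertices of a Steiner tree at depth `δ` from the root, with their parents. -/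
theorem IsSteinerTree.exists_depth {T : (⊤ : SimpleGraph (Fin I.n)).Subgraph}
    (hT : I.IsSteinerTree T) : ∃ (δ : Fin I.n → ℕ) (parent : Fin I.n → Fin I.n),
      (∀ v ∈ T.verts, δ v < I.levels ∧ (δ v = 0 ↔ v = I.root)) ∧
      ∀ v ∈ T.verts, v ≠ I.root → T.Adj v (parent v) ∧ δ (parent v) < δ v := by
  classical
  have hr : I.root ∈ T.verts := hT.terminals_subset _ I.root_mem
  have hconn := hT.isTree.connected
  let δ : Fin I.n → ℕ := fun v => if h : v ∈ T.verts then T.coe.dist ⟨I.root, hr⟩ ⟨v, h⟩ else 0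
  have hδ : ∀ v (h : v ∈ T.verts), δ v = T.coe.dist ⟨I.root, hr⟩ ⟨v, h⟩ := fun v h => by
    simp [δ, h]
  have hp : ∀ v : Fin I.n, ∃ p, v ∈ T.verts → v ≠ I.root → T.Adj v p ∧ δ p < δ v := by
    intro v
    by_cases hv : v ∈ T.verts ∧ v ≠ I.root
    · obtain ⟨q, hq⟩ := hconn.exists_walk_length_eq_dist ⟨v, hv.1⟩ ⟨I.root, hr⟩
      cases q with
      | nil => exact absurd rfl hv.2
      | @cons _ u _ hvu q =>
        refine ⟨u, fun _ _ => ⟨hvu, ?_⟩⟩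
        rw [hδ v hv.1, hδ u u.2, T.coe.dist_comm, T.coe.dist_comm (v := ⟨v, hv.1⟩), ← hq]
        have := SimpleGraph.dist_le q
        simp only [SimpleGraph.Walk.length_cons]
        exact Nat.lt_succ_of_le this
    · exact ⟨v, fun h₁ h₂ => absurd ⟨h₁, h₂⟩ hv⟩
  choose parent hparent using hp
  refine ⟨δ, parent, fun v hv => ⟨?_, ?_⟩, hparent⟩
  · obtain ⟨q, hq, hl⟩ := hconn.exists_path_of_dist ⟨I.root, hr⟩ ⟨v, hv⟩
    have h₁ := hT.depth_le hr ⟨v, hv⟩ q hq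
    have h₂ := hq.length_lt
    have h₃ : Fintype.card T.verts ≤ I.n := by
      simpa using Fintype.card_subtype_le (· ∈ T.verts)
    rw [hδ v hv, ← hl, levels]
    have := le_min h₁ (h₂.le.trans h₃)
    omega
  · rw [hδ v hv, hconn.dist_eq_zero_iff, Subtype.mk.injEq, eq_comm]

theorem IsSteinerTree.exists_totalCost_le {T : (⊤ : SimpleGraph (Fin I.n)).Subgraph}
    (hT : I.IsSteinerTree T) (hpar : I.IsParentMap par) :
    ∃ τ : ℕ → ℕ, (∀ v < I.n, τ v < I.numStates) ∧ I.totalCost par τ ≤ I.cost T := by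
  classical
  obtain ⟨δ, parent, hδ, hparent⟩ := hT.exists_depth
  have hr : I.root ∈ T.verts := hT.terminals_subset _ I.root_mem
  let L : ℕ → Finset (Fin I.n) := fun i => Finset.univ.filter fun v => v ∈ T.verts ∧ δ v ≤ i
  have hL : ∀ i v, v ∈ L i ↔ v ∈ T.verts ∧ δ v ≤ i := by simp [L]
  have hrL : ∀ i, I.root ∈ L i := fun i => (hL i _).2 ⟨hr, by rw [(hδ _ hr).2.2 rfl]; omega⟩
  choose near hnear using fun (v : Fin I.n) (i : ℕ) => exists_isNearest ⟨_, hrL i⟩ v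
  choose state hstate hdigit using fun v => exists_state (near v)
  obtain ⟨τ, hτ⟩ : ∃ τ : ℕ → ℕ, ∀ v : Fin I.n, τ v = state v :=
    ⟨fun v => if h : v < I.n then state ⟨v, h⟩ else 0, fun v => by simp⟩
  have hnear_eq : ∀ v i, near v i = v ↔ v ∈ L i := fun v i =>
    ⟨fun h => by have := (hnear v i).mem; rwa [h] at this, (hnear v i).eq_self⟩
  have hdig : ∀ (v : Fin I.n), ∀ i < I.levels, I.digit (τ v) i = near v i := fun v i hi => by
    rw [hτ, hdigit v i hi]
  -- A tree vertex names itself at level `i` exactly if its depth is at most `i`.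
  have hlabel : ∀ v ∈ T.verts, I.label v (τ v) = δ v := fun v hv => by
    refine label_eq (hδ v hv).1 ?_ fun j hj => ?_
    · rw [hdig v _ (hδ v hv).1, (hnear_eq v _).2 ((hL _ _).2 ⟨hv, le_rfl⟩)]
    · rw [hdig v _ (hj.trans (hδ v hv).1)]
      intro h
      have := ((hL _ _).1 ((hnear_eq v j).1 (Fin.ext h))).2
      omega
  have hlabel' : ∀ v, v ∉ T.verts → ¬ I.label v (τ v) < I.levels := fun v hv => by
    refine not_lt.2 (le_label fun i hi => ?_)
    rw [hdig v i hi]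
    intro h
    exact hv ((hL _ _).1 ((hnear_eq v i).1 (Fin.ext h))).1
  have hvalid : I.Valid par τ := by
    refine ⟨fun v hv => ?_, fun v hv ht => ?_, fun v hv hvr i hi => ?_⟩
    · have h₁ := hdig ⟨v, hv⟩ 0 (Nat.succ_pos _)
      have h₂ := (hL _ _).1 (hnear ⟨v, hv⟩ 0).mem
      rw [((hδ _ h₂.1).2).1 (by omega)] at h₁
      exact h₁
    · obtain ⟨u, hu, rfl⟩ := ht
      have hu := hT.terminals_subset u hu
      rw [hlabel u hu]
      exact (hδ u hu).1
    · have hp := (hpar.isParent v hv hvr).lt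
      exact (hnear ⟨v, hv⟩ i).not_conflict (hnear ⟨par v, hp⟩ i) (hdig ⟨v, hv⟩ i hi)
        (hdig ⟨par v, hp⟩ i hi)
  refine ⟨τ, fun v hv => by rw [hτ ⟨v, hv⟩]; exact hstate _, ?_⟩
  rw [hvalid.totalCost_eq, ← Fin.sum_univ_eq_sum_range (fun v => if 0 < I.label v (τ v) ∧
    I.label v (τ v) < I.levels then I.matrix v (I.digit (τ v) (I.label v (τ v) - 1)) else 0)]
  -- The parent in `T` belongs to `L (δ v - 1)`, so the named point is no farther away.
  have hterm : ∀ v : Fin I.n, (if 0 < I.label v (τ v) ∧ I.label v (τ v) < I.levels then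
      I.matrix v (I.digit (τ v) (I.label v (τ v) - 1)) else 0) ≤
      if v ∈ T.verts ∧ v ≠ I.root then I.edgeCost s(v, parent v) else 0 := by
    intro v
    by_cases hv : v ∈ T.verts
    · by_cases hvr : v = I.root
      · have : I.label v (τ v) = 0 := by rw [hlabel v hv, (hδ v hv).2.2 hvr]
        rw [if_neg (by omega), if_neg (by simp [hvr])]
      · have h0 : δ v ≠ 0 := fun h => hvr ((hδ v hv).2.1 h)
        have hl := (hδ v hv).1
        rw [hlabel v hv, if_pos ⟨by omega, hl⟩, if_pos ⟨hv, hvr⟩, hdig v _ (by omega), matrix_fin]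
        obtain ⟨h₁, h₂⟩ := hparent v hv hvr
        exact (hnear v _).dist_le (parent v) ((hL _ _).2 ⟨T.edge_vert h₁.symm, by omega⟩)
    · rw [if_neg fun h => hlabel' v hv h.2, if_neg fun h => hv h.1]
  refine (Finset.sum_le_sum fun v _ => hterm v).trans ?_
  rw [← Finset.sum_filter, cost, ← Finset.sum_image (f := I.edgeCost) (g := fun v => s(v, parent v))]
  · refine Finset.sum_le_sum_of_subset_of_nonneg (fun e he => ?_) fun e _ _ => ?_
    · obtain ⟨v, hv, rfl⟩ := Finset.mem_image.1 he
      have hv := (Finset.mem_filter.1 hv).2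
      simpa using (hparent v hv.1 hv.2).1
    · induction e using Sym2.ind with
      | _ u v => exact I.dist_nonneg u v
  -- An edge obtained from both of its ends would make each end strictly less deep than the other.
  · intro u hu v hv huv
    have hu := (Finset.mem_filter.1 hu).2
    have hv := (Finset.mem_filter.1 hv).2
    rcases Sym2.eq_iff.1 huv with h | h
    · exact h.1
    · have h₁ := (hparent u hu.1 hu.2).2
      have h₂ := (hparent v hv.1 hv.2).2
      rw [h.2] at h₁
      rw [← h.1] at h₂
      omega

/-- Joining all points to the root costs less than the penalty. -/
theorem exists_totalCost_lt (hpar : I.IsParentMap par) :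
    ∃ τ : ℕ → ℕ, (∀ v < I.n, τ v < I.numStates) ∧ I.totalCost par τ < I.big := by
  -- The star at the root: `v` names the root at depth 0 and itself at all later depths. Points that
  -- name themselves never conflict, as distinct points have positive distance.
  choose state hstate hdigit using fun v : Fin I.n =>
    exists_state fun i => if i = 0 then I.root else v
  obtain ⟨τ, hτ⟩ : ∃ τ : ℕ → ℕ, ∀ v : Fin I.n, τ v = state v :=
    ⟨fun v => if h : v < I.n then state ⟨v, h⟩ else 0, fun v => by simp⟩
  have hl : 1 < I.levels := by
    have := le_min I.one_le_k I.n_pos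
    rw [levels]
    omega
  have hdig : ∀ v < I.n, ∀ i < I.levels, I.digit (τ v) i = if i = 0 then (I.root : ℕ) else v := by
    intro v hv i hi
    rw [hτ ⟨v, hv⟩, hdigit ⟨v, hv⟩ i hi]
    split_ifs <;> rfl
  have hlab : ∀ v < I.n, I.label v (τ v) ≤ 1 := fun v hv =>
    label_le (by rw [hdig v hv 1 hl]; simp)
  have hvalid : I.Valid par τ := by
    refine ⟨fun v hv => by rw [hdig v hv 0 (by omega)]; simp, fun v hv _ =>
      (hlab v hv).trans_lt hl, fun v hv hvr i hi hc => ?_⟩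
    have hp := hpar.isParent v hv hvr
    have h₁ := I.matrix_pos hp.lt hv hp.ne
    have h₂ := I.matrix_comm v (par v)
    by_cases h0 : i = 0
    · exact hc.1 (by rw [hdig v hv i hi, hdig _ hp.lt i hi]; simp [h0])
    · refine hc.2 ?_
      simp only [hdig v hv i hi, hdig _ hp.lt i hi, h0, if_false, matrix_self]
      constructor <;> linarith
  refine ⟨τ, fun v hv => by rw [hτ ⟨v, hv⟩]; exact hstate _, ?_⟩
  rw [hvalid.totalCost_eq, big]
  refine lt_of_le_of_lt (Finset.sum_le_sum (g := fun v => I.matrix I.root v) fun v hv => ?_)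
    (by linarith)
  have hv := Finset.mem_range.1 hv
  split_ifs with h
  · have : I.label v (τ v) = 1 := by have := hlab v hv; omega
    rw [this, hdig v hv _ (by omega), matrix_comm]
    simp
  · exact I.matrix_nonneg _ _

end Problem

end KHop

/-- On tree metrics, the minimum-cost `k`-hop Steiner tree problem is solved exactly in
time `n ^ O(k)`, by one program for all `n` and `k`. -/
theorem theorem4 :
    ∃ (P : KHop.Prog) (C : ℕ), ∀ I : KHop.Problem, KHop.IsTreeMetric I.dist →
      ∃ (t : ℕ) (s : KHop.Store), KHop.Exec P I.input t s ∧ t ≤ C * I.n ^ (C * I.k) ∧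
        ∃ T : (⊤ : SimpleGraph (Fin I.n)).Subgraph, I.IsOutput s T ∧ I.IsOptimal T := by
  refine ⟨KHop.steinerProg, 1000, fun I ht => ?_⟩
  obtain ⟨t, s, hex, htime, par, σ, hpar, hmin, h4, h5⟩ := KHop.runs_steinerProg I
  obtain ⟨τ, hτ, hlt⟩ := KHop.Problem.exists_totalCost_lt hpar
  obtain ⟨T, hT, hcost, hverts, hadj⟩ :=
    (KHop.Problem.valid_of_totalCost_lt ((hmin τ hτ).trans_lt hlt)).exists_isSteinerTree hpar ht
  refine ⟨t, s, hex, htime, T, ⟨fun v => ?_, fun u v => ?_⟩, hT, fun T' hT' => ?_⟩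
  · rw [h4 v v.2, hverts]
    split_ifs with h <;> simp [h]
  · rw [h5 u u.2 v v.2, hadj]
    split_ifs with h <;> simp [h]
  · obtain ⟨τ', hτ', hle⟩ := hT'.exists_totalCost_le hpar
    exact hcost.trans ((hmin τ' hτ').trans hle)
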